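/- Let $k$ be an algebraically closed field of characteristic $0$ and let $H$ be a semisimple Hopf algebra over $k$ with comultiplication $\Delta$, counit $\varepsilon$ and antipode $S$. Let $\Lambda\in H$ be the unique two-sided integral with $\varepsilon(\Lambda)=1$, and write $\Delta(\Lambda)=\sum_{(\Lambda)}\Lambda_1\otimes\Lambda_2$. Let $\tau$ be a Hopf algebra automorphism of $H$ with $\tau^2=\mathrm{Id}$. Let $V$ be a finite-dimensional irreducible left $H$-module with character $\chi(h)=\operatorname{tr}_V(h)$. The second twisted Frobenius–Schur indicator is $$\nu_2(\chi,\tau)=\sum_{(\Lambda)}\chi\bigl(\Lambda_1\,\tau(\Lambda_2)\bigr)\in k .$$ The twisted dual $V^\dagger$ is the dual space $V^*$ with the $H$-action $(h\cdot f)(v)=f\bigl(\tau(S(h))\cdot v\bigr)$. An $H$-linear map $\varphi\colon V\to V^\dagger$ is symmetric (resp. skew-symmetric) if $\varphi(v)(w)=\varphi(w)(v)$ (resp. $\varphi(v)(w)=-\varphi(w)(v)$) for all $v,w\in V$. Then: 1. $\nu_2(\chi,\tau)\in\{0,1,-1\}$. 2. $\nu_2(\chi,\tau)\neq 0$ if and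 only if $V\cong V^\dagger$ as $H$-modules. Moreover, $\nu_2(\chi,\tau)=1$ (resp. $-1$) if and only if there is a nonzero symmetric (resp. skew-symmetric) $H$-linear map $V\to V^\dagger$. -/

import Mathlib

namespace TwistedFS

section Integral

/-- A two-sided integral `L` of a Hopf algebra, normalized by `ε(L) = 1`. -/
structure IsNormalizedIntegral (k : Type*) {H : Type*} [Field k] [Ring H] [HopfAlgebra k H]
    (L : H) : Prop where
  /-- `L` is a left integral. -/
  mul_left : ∀ h : H, h * L = Coalgebra.counit (R := k) h • L
  /-- `L` is a right integral. -/
  mul_right : ∀ h : H, L * h = Coalgebra.counit (R := k) h • L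
  /-- `L` is normalized. -/
  counit_eq : Coalgebra.counit (R := k) L = 1

theorem exists_left_eigenvector {k A : Type*} [Field k] [Ring A] [Algebra k A]
    [IsSemisimpleRing A] (e : A →ₐ[k] k) :
    ∃ L : A, e L = 1 ∧ ∀ h : A, h * L = e h • L := by
  obtain ⟨q, hq⟩ := exists_isCompl (RingHom.ker e : Ideal A)
  have h1 : (1 : A) ∈ (RingHom.ker e : Ideal A) ⊔ q := by rw [hq.sup_eq_top]; trivial
  obtain ⟨a, ha, L, hL, haL⟩ := Submodule.mem_sup.1 h1
  have ha' : e a = 0 := ha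
  refine ⟨L, ?_, fun h => ?_⟩
  · have := congrArg e haL
    simpa [ha'] using this
  · have hmem : (h - algebraMap k A (e h)) * L ∈ (RingHom.ker e : Ideal A) ⊓ q := by
      refine ⟨?_, q.smul_mem _ hL⟩
      change e _ = 0
      rw [map_mul, map_sub, AlgHom.commutes]
      simp
    rw [hq.inf_eq_bot] at hmem
    have h0 : (h - algebraMap k A (e h)) * L = 0 := hmem
    rw [sub_mul, sub_eq_zero] at h0
    rw [h0, Algebra.smul_def]

theorem existsUnique_normalizedIntegral (k H : Type*) [Field k] [Ring H] [HopfAlgebra k H]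
    [IsSemisimpleRing H] : ∃! L : H, IsNormalizedIntegral k L := by
  obtain ⟨L, hL1, hL⟩ := exists_left_eigenvector (Bialgebra.counitAlgHom k H)
  obtain ⟨R, hR1, hR⟩ := exists_left_eigenvector (A := Hᵐᵒᵖ)
    ((Bialgebra.counitAlgHom k H).fromOpposite fun _ _ => Commute.all _ _)
  have hR' : ∀ h : H, R.unop * h = Coalgebra.counit (R := k) h • R.unop := fun h => by
    have := congrArg MulOpposite.unop (hR (MulOpposite.op h))
    simpa using this
  have hR1' : Coalgebra.counit (R := k) R.unop = 1 := by simpa using hR1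
  have hL1' : Coalgebra.counit (R := k) L = 1 := by simpa using hL1
  have hL' : ∀ h : H, h * L = Coalgebra.counit (R := k) h • L := fun h => by
    simpa using hL h
  have key : ∀ L' : H, (∀ h : H, h * L' = Coalgebra.counit (R := k) h • L') →
      Coalgebra.counit (R := k) L' = 1 → L' = R.unop := fun L' h1 h2 => by
    have e1 := h1 R.unop
    have e2 := hR' L'
    rw [hR1', one_smul] at e1
    rw [h2, one_smul] at e2
    exact e1.symm.trans e2
  have hLR := key L hL' hL1'
  exact ⟨L, ⟨hL', by rw [hLR]; exact hR', hL1'⟩, fun L' h => (key L' h.1 h.3).trans hLR.symm⟩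

/-- The unique normalized two-sided integral `Λ` of a semisimple Hopf algebra. -/
noncomputable def integral (k H : Type*) [Field k] [Ring H] [HopfAlgebra k H]
    [IsSemisimpleRing H] : H :=
  (existsUnique_normalizedIntegral k H).choose

theorem integral_spec (k H : Type*) [Field k] [Ring H] [HopfAlgebra k H]
    [IsSemisimpleRing H] : IsNormalizedIntegral k (integral k H) :=
  (existsUnique_normalizedIntegral k H).choose_spec.1

end Integral

section Indicator

/-- The character `χ(h) = tr_V(h)` of a finite-dimensional left `H`-module `V`. -/
noncomputable def character (k H V : Type*) [Field k] [Ring H] [Algebra k H] [AddCommGroup V]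
    [Module k V] [Module H V] [IsScalarTower k H V] : H →ₗ[k] k :=
  LinearMap.trace k V ∘ₗ (Algebra.lsmul k k V : H →ₐ[k] Module.End k V).toLinearMap

/-- The second twisted Frobenius–Schur indicator `ν₂(χ, τ) = ∑ χ(Λ₁ τ(Λ₂))`. -/
noncomputable def indicator {k H : Type*} [Field k] [Ring H] [HopfAlgebra k H]
    [IsSemisimpleRing H] (χ : H →ₗ[k] k) (τ : H ≃ₐc[k] H) : k :=
  χ (LinearMap.mul' k H
    (TensorProduct.map LinearMap.id (τ : H ≃ₐ[k] H).toLinearMap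
      (Coalgebra.comul (R := k) (integral k H))))

end Indicator

section TwistedDual

/-- The twisted dual `V^†`: as a vector space it is the dual `V*`; the `H`-action, given below,
is `(h • f)(v) = f(τ(S(h)) • v)`. -/
def TwistedDual {k H : Type*} [Field k] [Ring H] [HopfAlgebra k H] (_τ : H ≃ₐc[k] H)
    (V : Type*) [AddCommGroup V] [Module k V] : Type _ :=
  Module.Dual k V

variable {k H : Type*} [Field k] [Ring H] [HopfAlgebra k H] (τ : H ≃ₐc[k] H)
  (V : Type*) [AddCommGroup V] [Module k V]

instance : AddCommGroup (TwistedDual τ V) :=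
  inferInstanceAs (AddCommGroup (Module.Dual k V))

instance : Module k (TwistedDual τ V) :=
  inferInstanceAs (Module k (Module.Dual k V))

/-- The identity map `V^† → V*`. -/
def TwistedDual.toDual : TwistedDual τ V ≃ₗ[k] Module.Dual k V :=
  LinearEquiv.refl k (Module.Dual k V)

variable [Module H V] [IsScalarTower k H V]

/-- The action of `H` on `V^†` through `T = τ S`. -/
noncomputable instance : Module H (TwistedDual τ V) where
  smul h f := (TwistedDual.toDual τ V).symm
    (TwistedDual.toDual τ V f ∘ₗ Algebra.lsmul k k V (τ (HopfAlgebra.antipode k h)))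
  one_smul f := by
    apply (TwistedDual.toDual τ V).injective
    ext v
    change TwistedDual.toDual τ V f (τ (HopfAlgebra.antipode k (1 : H)) • v) = _
    rw [HopfAlgebra.antipode_one, map_one, one_smul]
  mul_smul a b f := by
    apply (TwistedDual.toDual τ V).injective
    ext v
    change TwistedDual.toDual τ V f (τ (HopfAlgebra.antipode k (a * b)) • v) =
      TwistedDual.toDual τ V f (τ (HopfAlgebra.antipode k b) •
        τ (HopfAlgebra.antipode k a) • v)
    rw [HopfAlgebra.antipode_mul_antidistrib, map_mul, mul_smul]
  smul_zero a := by
    apply (TwistedDual.toDual τ V).injective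
    ext v
    rfl
  smul_add a f g := by
    apply (TwistedDual.toDual τ V).injective
    ext v
    rfl
  add_smul a b f := by
    apply (TwistedDual.toDual τ V).injective
    ext v
    change TwistedDual.toDual τ V f (τ (HopfAlgebra.antipode k (a + b)) • v) =
      TwistedDual.toDual τ V f (τ (HopfAlgebra.antipode k a) • v) +
      TwistedDual.toDual τ V f (τ (HopfAlgebra.antipode k b) • v)
    rw [map_add, map_add, add_smul, map_add]
  zero_smul f := by
    apply (TwistedDual.toDual τ V).injective
    ext v
    change TwistedDual.toDual τ V f (τ (HopfAlgebra.antipode k (0 : H)) • v) = 0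
    rw [map_zero, map_zero, zero_smul, map_zero]

theorem TwistedDual.toDual_smul_apply (h : H) (f : TwistedDual τ V) (v : V) :
    TwistedDual.toDual τ V (h • f) v =
      TwistedDual.toDual τ V f (τ (HopfAlgebra.antipode k h) • v) := rfl

variable {τ V}

/-- An `H`-map `φ : V → V^†` is symmetric if it equals its transpose, that is, if the bilinear
form `(v, w) ↦ φ(v)(w)` is symmetric. -/
def IsSymmetric (φ : V →ₗ[H] TwistedDual τ V) : Prop :=
  ∀ v w : V, TwistedDual.toDual τ V (φ v) w = TwistedDual.toDual τ V (φ w) v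

/-- An `H`-map `φ : V → V^†` is skew-symmetric if it equals minus its transpose. -/
def IsSkewSymmetric (φ : V →ₗ[H] TwistedDual τ V) : Prop :=
  ∀ v w : V, TwistedDual.toDual τ V (φ v) w = -TwistedDual.toDual τ V (φ w) v

end TwistedDual

end TwistedFS

/-!
# Twisted Frobenius–Schur indicators

On bilinear forms on `V`, let `E` be the averaging operator `β ↦ ∑ β(Λ₁ ·, τ(Λ₂) ·)` and `σ` the
flip. The identity `∑ Λ₁h ⊗ Λ₂ = ∑ Λ₁ ⊗ Λ₂S(h)` shows that `E` projects onto the forms of `H`-maps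
`V → V^†` (`average_mem`, `average_toForm`), and the trace of `E ∘ σ` is `ν₂(χ, τ)`
(`trace_formAction_comp_flip`). By Schur's lemma the image of `E` has dimension at most one. If it
is zero, so is the indicator. Otherwise it is spanned by one form, which `σ` multiplies by a sign,
and the indicator is that sign (`toForm_swap`).

That `σ` preserves the forms of `H`-maps needs `τ² = 1` and `S² = 1`. The latter is the theorem of
Larson and Radford, `antipode_antipode_of_isSemisimpleRing`, and most of the file proves it.

* The map `p ↦ ∑ p(Λ₁)Λ₂` from `H*` to `H` is onto and `H` is finite-dimensional; the functional `l`
  sent to `1` is a right integral of `H*`, and a Frobenius form with Nakayama automorphism `S²`.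
  The left integral `l ∘ S` produces a grouplike element `g` with `S⁴(x) g = g x`.
* The trace of `y ↦ x S²(y)` is `l(S(x))`. In particular `tr(S²) = l(1)`.
* `tr(S²) ≠ 0` (`IsDualIntegral.apply_one_ne_zero`): `H` is a product of matrix algebras, and `S²`
  is conjugation by `u`, which has a power central because `g` has finite order. Hence `tr(S²)` is
  a sum of terms `tr(uᵢ) tr(uᵢ⁻¹)`, each sent to some `|z|²` by a complex embedding of the algebraic
  numbers. These terms do not all vanish, since weighted by the scalars by which `Λ` acts they add
  up to `l(S(Λ)) = 1`.
* As `l(1) ≠ 0`, the left and right integrals agree, so `g = 1` and `S⁴ = 1`.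
* The character `x` of the regular comodule satisfies `x² = (dim H) x`, `S²(x) = x` and
  `l(S(x)) = l(1)`. So `tr(S²) / dim H` is the trace of `S²` on the image of the idempotent
  `x / dim H`, an integer. The trace of an involution is nonzero and divisible by the dimension
  only if the involution is `± 1`, and `S²(1) = 1`.
-/

open TensorProduct Coalgebra HopfAlgebra

namespace TwistedFS

/-! ### Slices of the comultiplication, and the antipode as an anti-homomorphism of coalgebras -/

section Slices

variable {k H : Type*} [Field k] [Ring H] [HopfAlgebra k H]

/-- The operator `h ↦ ∑ p(h₁) h₂`. -/
noncomputable def hitLeft (p : Module.Dual k H) : H →ₗ[k] H :=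
  (TensorProduct.lid k H).toLinearMap ∘ₗ p.rTensor H ∘ₗ comul

/-- The operator `h ↦ ∑ h₁ p(h₂)`. -/
noncomputable def hitRight (p : Module.Dual k H) : H →ₗ[k] H :=
  (TensorProduct.rid k H).toLinearMap ∘ₗ p.lTensor H ∘ₗ comul

theorem hitLeft_apply (p : Module.Dual k H) (h : H) :
    hitLeft p h = TensorProduct.lid k H (p.rTensor H (comul h)) := rfl

theorem hitRight_apply (p : Module.Dual k H) (h : H) :
    hitRight p h = TensorProduct.rid k H (p.lTensor H (comul h)) := rfl

theorem hitLeft_one (p : Module.Dual k H) : hitLeft p 1 = p 1 • (1 : H) := by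
  simp [hitLeft_apply, Algebra.TensorProduct.one_def]

theorem hitLeft_smul (c : k) (p : Module.Dual k H) : hitLeft (c • p) = c • hitLeft p := by
  ext h
  simp [hitLeft_apply, LinearMap.rTensor_smul]

theorem counit_hitLeft (p : Module.Dual k H) (h : H) :
    counit (R := k) (hitLeft p h) = p h := by
  have h1 : ∀ T : H ⊗[k] H, counit (R := k) (TensorProduct.lid k H (p.rTensor H T)) =
      p (TensorProduct.rid k H ((counit (R := k)).lTensor H T)) := fun T => by
    induction T with
    | zero => simp
    | add a b ha hb => simp only [map_add, ha, hb]
    | tmul a b => simp [mul_comm]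
  rw [hitLeft_apply, h1]
  simp

/-- Both sides are `∑ p(h₁) f(h₂) h₃`: composition of these operators corresponds to the convolution
product of functionals. -/
theorem hitLeft_comp_hitLeft (f p : Module.Dual k H) (h : H) :
    hitLeft (f ∘ₗ hitLeft p) h = hitLeft f (hitLeft p h) := by
  have h1 : ∀ T : H ⊗[k] H, comul (R := k) (TensorProduct.lid k H (p.rTensor H T)) =
      TensorProduct.lid k (H ⊗[k] H) (p.rTensor (H ⊗[k] H) ((comul (R := k)).lTensor H T)) :=
    fun T => by
    induction T with
    | zero => simp
    | add a b ha hb => simp only [map_add, ha, hb]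
    | tmul a b => simp
  have h2 : ∀ T : H ⊗[k] H, TensorProduct.lid k H ((f ∘ₗ hitLeft p).rTensor H T) =
      TensorProduct.lid k H (f.rTensor H (TensorProduct.lid k (H ⊗[k] H)
        (p.rTensor (H ⊗[k] H) (TensorProduct.assoc k H H H
          ((comul (R := k)).rTensor H T))))) := fun T => by
    induction T with
    | zero => simp
    | add a b ha hb => simp only [map_add, ha, hb]
    | tmul a b =>
      simp only [LinearMap.rTensor_tmul, TensorProduct.lid_tmul, LinearMap.comp_apply,
        hitLeft_apply]
      generalize comul (R := k) a = W
      induction W with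
      | zero => simp
      | add a b ha hb => simp only [map_add, TensorProduct.add_tmul, add_smul, ha, hb]
      | tmul c d => simp [mul_smul, TensorProduct.smul_tmul']
  rw [hitLeft_apply, h2, Coalgebra.coassoc_apply, ← h1]
  rfl

/-- Both sides are `∑ h₁ p(h₂) f(h₃)`. -/
theorem hitRight_comp_hitLeft (f p : Module.Dual k H) (h : H) :
    hitRight (f ∘ₗ hitLeft p) h =
      TensorProduct.rid k H (TensorProduct.map (hitRight p) f (comul h)) := by
  have h1 : ∀ T : H ⊗[k] H, TensorProduct.rid k H ((f ∘ₗ hitLeft p).lTensor H T) =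
      TensorProduct.rid k H (TensorProduct.map ((TensorProduct.rid k H).toLinearMap ∘ₗ p.lTensor H)
        f ((TensorProduct.assoc k H H H).symm ((comul (R := k)).lTensor H T))) := fun T => by
    induction T with
    | zero => simp
    | add a b ha hb => simp only [map_add, ha, hb]
    | tmul a b =>
      simp only [LinearMap.lTensor_tmul, TensorProduct.rid_tmul, LinearMap.comp_apply,
        hitLeft_apply]
      generalize comul (R := k) b = W
      induction W with
      | zero => simp
      | add a b ha hb => simp only [map_add, TensorProduct.tmul_add, add_smul, ha, hb]
      | tmul c d => simp [mul_smul, mul_comm (p c)]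
  have h2 : ∀ T : H ⊗[k] H, TensorProduct.map (hitRight p) f T =
      TensorProduct.map ((TensorProduct.rid k H).toLinearMap ∘ₗ p.lTensor H)
        f ((comul (R := k)).rTensor H T) := fun T => by
    induction T with
    | zero => simp
    | add a b ha hb => simp only [map_add, ha, hb]
    | tmul a b => simp [hitRight_apply]
  rw [hitRight_apply, h1, h2, Coalgebra.coassoc_symm_apply]

/-- Functionals applied to the first leg separate the elements of `H ⊗ H`. -/
theorem eq_of_lid_rTensor_eq {S T : H ⊗[k] H}
    (h : ∀ f : Module.Dual k H, TensorProduct.lid k H (f.rTensor H S) =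
      TensorProduct.lid k H (f.rTensor H T)) : S = T := by
  classical
  let B := Module.Basis.ofVectorSpace k H
  apply (TensorProduct.equivFinsuppOfBasisLeft (N := H) B).injective
  ext i
  simpa [TensorProduct.equivFinsuppOfBasisLeft_apply] using h (B.coord i)

end Slices

section Antipode

variable {k H : Type*} [Field k] [Ring H] [HopfAlgebra k H]

/-- `∑ (S(h₁) ⊗ 1) Δ(h₂) = 1 ⊗ h`. -/
theorem antipode_tmul_one_mul_comul (h : H) :
    LinearMap.mul' k (H ⊗[k] H) (TensorProduct.map
      ((Algebra.TensorProduct.includeLeft : H →ₐ[k] H ⊗[k] H).toLinearMap ∘ₗ antipode k)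
      (comul (R := k)) (comul h)) = (1 : H) ⊗ₜ[k] h := by
  have h1 : ∀ T : H ⊗[k] H, LinearMap.mul' k (H ⊗[k] H) (TensorProduct.map
      ((Algebra.TensorProduct.includeLeft : H →ₐ[k] H ⊗[k] H).toLinearMap ∘ₗ antipode k)
      (comul (R := k)) T) =
      (LinearMap.mul' k H ∘ₗ (antipode k).rTensor H).rTensor H ((TensorProduct.assoc k H H H).symm
        ((comul (R := k)).lTensor H T)) := fun T => by
    induction T with
    | zero => simp
    | add a b ha hb => simp only [map_add, ha, hb]
    | tmul a b =>
      simp only [LinearMap.lTensor_tmul, TensorProduct.map_tmul, LinearMap.mul'_apply]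
      generalize comul (R := k) b = W
      induction W with
      | zero => simp
      | add a b ha hb => simp only [map_add, TensorProduct.tmul_add, mul_add, ha, hb]
      | tmul c d => simp
  rw [h1, Coalgebra.coassoc_symm_apply, ← LinearMap.rTensor_comp_apply, LinearMap.comp_assoc,
    HopfAlgebra.mul_antipode_rTensor_comul, LinearMap.rTensor_comp_apply]
  simp

/-- `∑ Δ(h₁) (1 ⊗ S(h₂)) = h ⊗ 1`. -/
theorem comul_mul_one_tmul_antipode (h : H) :
    LinearMap.mul' k (H ⊗[k] H) (TensorProduct.map (comul (R := k))
      ((Algebra.TensorProduct.includeRight : H →ₐ[k] H ⊗[k] H).toLinearMap ∘ₗ antipode k)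
      (comul h)) = h ⊗ₜ[k] (1 : H) := by
  have h1 : ∀ T : H ⊗[k] H, LinearMap.mul' k (H ⊗[k] H) (TensorProduct.map (comul (R := k))
      ((Algebra.TensorProduct.includeRight : H →ₐ[k] H ⊗[k] H).toLinearMap ∘ₗ antipode k) T) =
      (LinearMap.mul' k H ∘ₗ (antipode k).lTensor H).lTensor H (TensorProduct.assoc k H H H
        ((comul (R := k)).rTensor H T)) := fun T => by
    induction T with
    | zero => simp
    | add a b ha hb => simp only [map_add, ha, hb]
    | tmul a b =>
      simp only [LinearMap.rTensor_tmul, TensorProduct.map_tmul, LinearMap.mul'_apply]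
      generalize comul (R := k) a = W
      induction W with
      | zero => simp
      | add a b ha hb => simp only [map_add, TensorProduct.add_tmul, add_mul, ha, hb]
      | tmul c d => simp
  rw [h1, Coalgebra.coassoc_apply, ← LinearMap.lTensor_comp_apply, LinearMap.comp_assoc,
    HopfAlgebra.mul_antipode_lTensor_comul, LinearMap.lTensor_comp_apply]
  simp

open WithConv in
/-- The antipode is an anti-homomorphism of coalgebras: `Δ(S(h)) = ∑ S(h₂) ⊗ S(h₁)`. Both sides
are convolution inverses of `Δ`. -/
theorem comul_antipode (h : H) :
    comul (R := k) (antipode k h) =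
      TensorProduct.map (antipode k) (antipode k) (TensorProduct.comm k H H (comul h)) := by
  let G : H →ₗ[k] H ⊗[k] H := TensorProduct.map (antipode k) (antipode k) ∘ₗ
    (TensorProduct.comm k H H).toLinearMap ∘ₗ comul
  have hG : toConv G * toConv (comul (R := k) (A := H)) = 1 := by
    apply WithConv.ext
    ext h
    let Φ : H ⊗[k] H →ₗ[k] H ⊗[k] H := LinearMap.mul' k (H ⊗[k] H) ∘ₗ TensorProduct.map
      ((Algebra.TensorProduct.includeLeft : H →ₐ[k] H ⊗[k] H).toLinearMap ∘ₗ antipode k)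
      (comul (R := k))
    let Ψ : H ⊗[k] (H ⊗[k] H) →ₗ[k] H ⊗[k] H := LinearMap.mul' k (H ⊗[k] H) ∘ₗ TensorProduct.map
      ((Algebra.TensorProduct.includeRight : H →ₐ[k] H ⊗[k] H).toLinearMap ∘ₗ antipode k) Φ
    have h1 : ∀ T : H ⊗[k] H, LinearMap.mul' k (H ⊗[k] H) (TensorProduct.map G comul T) =
        Ψ (TensorProduct.assoc k H H H ((comul (R := k)).rTensor H T)) := fun T => by
      induction T with
      | zero => simp
      | add a b ha hb => simp only [map_add, ha, hb]
      | tmul a b =>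
        simp only [LinearMap.rTensor_tmul, TensorProduct.map_tmul, LinearMap.mul'_apply, G,
          LinearMap.comp_apply]
        generalize comul (R := k) a = W
        induction W with
        | zero => simp
        | add a b ha hb => simp only [map_add, TensorProduct.add_tmul, add_mul, ha, hb]
        | tmul c d => simp [Ψ, Φ, ← mul_assoc]
    have h2 : ∀ T : H ⊗[k] H, Ψ ((comul (R := k)).lTensor H T) =
        (1 : H) ⊗ₜ[k] LinearMap.mul' k H ((antipode k).rTensor H T) := fun T => by
      induction T with
      | zero => simp
      | add a b ha hb => simp only [map_add, TensorProduct.tmul_add, ha, hb]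
      | tmul a b =>
        have := antipode_tmul_one_mul_comul (k := k) b
        simp only [LinearMap.lTensor_tmul, Ψ, LinearMap.comp_apply, TensorProduct.map_tmul, Φ,
          this]
        simp
    have h3 := h1 (comul h)
    rw [Coalgebra.coassoc_apply, h2, HopfAlgebra.mul_antipode_rTensor_comul_apply] at h3
    rw [LinearMap.convMul_def, LinearMap.convOne_def]
    simp only [LinearMap.comp_apply]
    rw [h3]
    simp [Algebra.algebraMap_eq_smul_one, Algebra.TensorProduct.one_def]
  have := left_inv_eq_right_inv hG (LinearMap.comul_right_inv (R := k) (C := H))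
  exact (congrArg (fun f => f.ofConv h) this).symm

end Antipode

/-! ### Integrals of a Hopf algebra and of its dual -/

section Integrals

variable {k H : Type*} [Field k] [Ring H] [HopfAlgebra k H]

theorem antipode_hitRight (p : Module.Dual k H) (h : H) :
    antipode k (hitRight (p ∘ₗ antipode k) h) = hitLeft p (antipode k h) := by
  rw [hitRight_apply, hitLeft_apply, comul_antipode]
  generalize comul (R := k) h = T
  induction T with
  | zero => simp
  | add a b ha hb => simp only [map_add, ha, hb]
  | tmul a b => simp

variable {L : H} (hL : IsNormalizedIntegral k L)

include hL in
/-- `∑ S(h)Λ₁ ⊗ Λ₂ = ∑ Λ₁ ⊗ hΛ₂`. -/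
theorem IsNormalizedIntegral.antipode_tmul_mul_comul (h : H) :
    (antipode k h ⊗ₜ[k] (1 : H)) * comul (R := k) L = ((1 : H) ⊗ₜ[k] h) * comul (R := k) L := by
  have h1 : ∀ T : H ⊗[k] H, LinearMap.mul' k (H ⊗[k] H) (TensorProduct.map
      ((Algebra.TensorProduct.includeLeft : H →ₐ[k] H ⊗[k] H).toLinearMap ∘ₗ antipode k)
      (comul (R := k)) T) * comul (R := k) L =
      (antipode k (TensorProduct.rid k H ((counit (R := k)).lTensor H T)) ⊗ₜ[k] (1 : H)) *
        comul (R := k) L := fun T => by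
    induction T with
    | zero => simp
    | add a b ha hb => simp only [map_add, TensorProduct.add_tmul, add_mul, ha, hb]
    | tmul a b =>
      simp only [TensorProduct.map_tmul, LinearMap.mul'_apply, mul_assoc, ← Bialgebra.comul_mul,
        hL.mul_left]
      simp [TensorProduct.smul_tmul', ← smul_mul_assoc]
  rw [← antipode_tmul_one_mul_comul, h1]
  simp

include hL in
/-- `∑ Λ₁h ⊗ Λ₂ = ∑ Λ₁ ⊗ Λ₂S(h)`. -/
theorem IsNormalizedIntegral.comul_mul_tmul (h : H) :
    comul (R := k) L * (h ⊗ₜ[k] (1 : H)) = comul (R := k) L * ((1 : H) ⊗ₜ[k] antipode k h) := by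
  have h1 : ∀ T : H ⊗[k] H, comul (R := k) L *
      LinearMap.mul' k (H ⊗[k] H) (TensorProduct.map (comul (R := k))
      ((Algebra.TensorProduct.includeRight : H →ₐ[k] H ⊗[k] H).toLinearMap ∘ₗ antipode k) T) =
      comul (R := k) L *
      ((1 : H) ⊗ₜ[k] antipode k (TensorProduct.lid k H ((counit (R := k)).rTensor H T))) :=
      fun T => by
    induction T with
    | zero => simp
    | add a b ha hb => simp only [map_add, TensorProduct.tmul_add, mul_add, ha, hb]
    | tmul a b =>
      simp only [TensorProduct.map_tmul, LinearMap.mul'_apply, ← mul_assoc, ← Bialgebra.comul_mul,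
        hL.mul_right]
      simp
  rw [← comul_mul_one_tmul_antipode, h1]
  simp

include hL in
theorem IsNormalizedIntegral.hitLeft_mulLeft_antipode (p : Module.Dual k H) (h : H) :
    hitLeft (p ∘ₗ LinearMap.mulLeft k (antipode k h)) L = h * hitLeft p L := by
  have h1 : ∀ T : H ⊗[k] H,
      TensorProduct.lid k H ((p ∘ₗ LinearMap.mulLeft k (antipode k h)).rTensor H T) =
      TensorProduct.lid k H (p.rTensor H ((antipode k h ⊗ₜ[k] (1 : H)) * T)) := fun T => by
    induction T with
    | zero => simp
    | add a b ha hb => simp only [map_add, mul_add, ha, hb]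
    | tmul a b => simp
  have h2 : ∀ T : H ⊗[k] H,
      TensorProduct.lid k H (p.rTensor H (((1 : H) ⊗ₜ[k] h) * T)) =
      h * TensorProduct.lid k H (p.rTensor H T) := fun T => by
    induction T with
    | zero => simp
    | add a b ha hb => simp only [map_add, mul_add, ha, hb]
    | tmul a b => simp
  rw [hitLeft_apply, h1, hL.antipode_tmul_mul_comul, h2, hitLeft_apply]

include hL in
theorem IsNormalizedIntegral.hitLeft_mulRight (p : Module.Dual k H) (h : H) :
    hitLeft (p ∘ₗ LinearMap.mulRight k h) L = hitLeft p L * antipode k h := by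
  have h1 : ∀ T : H ⊗[k] H,
      TensorProduct.lid k H ((p ∘ₗ LinearMap.mulRight k h).rTensor H T) =
      TensorProduct.lid k H (p.rTensor H (T * (h ⊗ₜ[k] (1 : H)))) := fun T => by
    induction T with
    | zero => simp
    | add a b ha hb => simp only [map_add, add_mul, ha, hb]
    | tmul a b => simp
  have h2 : ∀ T : H ⊗[k] H,
      TensorProduct.lid k H (p.rTensor H (T * ((1 : H) ⊗ₜ[k] antipode k h))) =
      TensorProduct.lid k H (p.rTensor H T) * antipode k h := fun T => by
    induction T with
    | zero => simp
    | add a b ha hb => simp only [map_add, add_mul, ha, hb]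
    | tmul a b => simp
  rw [hitLeft_apply, h1, hL.comul_mul_tmul, h2, hitLeft_apply]

/-- The map `p ↦ ∑ p(Λ₁) Λ₂`, as a linear map in `p`. -/
noncomputable def dualToHopf (L : H) : Module.Dual k H →ₗ[k] H where
  toFun p := hitLeft p L
  map_add' p q := by simp [hitLeft_apply, LinearMap.rTensor_add]
  map_smul' c p := by simp [hitLeft_smul]

include hL in
/-- The range of `p ↦ ∑ p(Λ₁) Λ₂` is a left ideal which contains all second legs of `Δ(Λ)`, hence
also `∑ S(Λ₁) Λ₂ = 1`. -/
theorem IsNormalizedIntegral.dualToHopf_surjective_and_finite :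
    Function.Surjective (dualToHopf (k := k) L) ∧ FiniteDimensional k H := by
  classical
  let B := Module.Basis.ofVectorSpace k H
  obtain ⟨b, hb⟩ := TensorProduct.eq_repr_basis_left B (comul (R := k) L)
  have happ : ∀ p : Module.Dual k H, dualToHopf L p = b.sum fun i m => p (B i) • m := fun p => by
    change hitLeft p L = _
    rw [hitLeft_apply, ← hb, Finsupp.sum, map_sum, map_sum]
    simp [Finsupp.sum]
  have hbi : ∀ i, dualToHopf (k := k) L (B.coord i) = b i := fun i => by
    rw [happ, Finsupp.sum]
    simp +contextual [Finsupp.single_apply, eq_comm]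
  have hideal : ∀ h p, h * dualToHopf (k := k) L p ∈ LinearMap.range (dualToHopf (k := k) L) :=
    fun h p => ⟨_, hL.hitLeft_mulLeft_antipode p h⟩
  have hone : (1 : H) ∈ LinearMap.range (dualToHopf (k := k) L) := by
    have h1 := HopfAlgebra.mul_antipode_rTensor_comul_apply (R := k) L
    rw [hL.counit_eq, map_one, ← hb, Finsupp.sum, map_sum, map_sum] at h1
    rw [← h1]
    refine Submodule.sum_mem _ fun i _ => ?_
    rw [← hbi i]
    simpa using hideal _ _
  have hsurj : Function.Surjective (dualToHopf (k := k) L) := fun h => by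
    obtain ⟨p, hp⟩ := hone
    have := hideal h p
    rwa [hp, mul_one] at this
  refine ⟨hsurj, ?_⟩
  refine Module.Finite.of_fg_top ⟨b.support.image b, ?_⟩
  refine eq_top_iff.2 fun h _ => ?_
  obtain ⟨p, rfl⟩ := hsurj h
  rw [happ]
  refine Submodule.sum_mem _ fun i hi => Submodule.smul_mem _ _ (Submodule.subset_span ?_)
  exact Finset.mem_coe.2 (Finset.mem_image_of_mem _ hi)

include hL in
theorem IsNormalizedIntegral.dualToHopf_bijective :
    Function.Bijective (dualToHopf (k := k) L) := by
  obtain ⟨h, _⟩ := hL.dualToHopf_surjective_and_finite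
  exact ⟨(LinearMap.injective_iff_surjective_of_finrank_eq_finrank
    Subspace.dual_finrank_eq).2 h, h⟩

/-- A functional `l` with `∑ l(Λ₁) Λ₂ = 1` for a normalized integral `Λ`. Such an `l` is a right
integral of the dual algebra (`hitLeft_self`), with the normalization `l(Λ) = 1`. -/
structure IsDualIntegral (L : H) (l : Module.Dual k H) : Prop where
  /-- `L` is a normalized integral. -/
  integral : IsNormalizedIntegral k L
  /-- `∑ l(Λ₁) Λ₂ = 1`. -/
  hit_eq_one : hitLeft l L = 1

include hL in
theorem IsNormalizedIntegral.exists_isDualIntegral :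
    ∃ l : Module.Dual k H, IsDualIntegral L l := by
  obtain ⟨l, hl⟩ := hL.dualToHopf_bijective.2 1
  exact ⟨l, hL, hl⟩

namespace IsDualIntegral

variable {l : Module.Dual k H} (hl : IsDualIntegral L l)

include hl

theorem dual_ext {p q : Module.Dual k H} (h : hitLeft p L = hitLeft q L) : p = q :=
  hl.integral.dualToHopf_bijective.1 h

theorem hit_mulLeft (h : H) :
    hitLeft (l ∘ₗ LinearMap.mulLeft k (antipode k h)) L = h := by
  rw [hl.integral.hitLeft_mulLeft_antipode, hl.hit_eq_one, mul_one]

theorem hit_mulRight (h : H) :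
    hitLeft (l ∘ₗ LinearMap.mulRight k h) L = antipode k h := by
  rw [hl.integral.hitLeft_mulRight, hl.hit_eq_one, one_mul]

theorem antipode_injective : Function.Injective (antipode k (A := H)) := fun a b hab => by
  rw [← hl.hit_mulLeft a, hab, hl.hit_mulLeft b]

theorem antipode_surjective : Function.Surjective (antipode k (A := H)) := by
  have := hl.integral.dualToHopf_surjective_and_finite.2
  exact LinearMap.injective_iff_surjective.1 hl.antipode_injective

/-- The Nakayama automorphism of the Frobenius form `l` is `S²`. -/
theorem apply_mul_comm (x h : H) : l (x * h) = l (antipode k (antipode k h) * x) := by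
  have := hl.dual_ext ((hl.hit_mulRight h).trans (hl.hit_mulLeft (antipode k h)).symm)
  exact LinearMap.congr_fun this x

/-- `l` is a Frobenius form: every functional is a translate of `l`. -/
theorem exists_eq_mulLeft (p : Module.Dual k H) :
    p = l ∘ₗ LinearMap.mulLeft k (antipode k (hitLeft p L)) :=
  hl.dual_ext (hl.hit_mulLeft _).symm

theorem eq_zero_of_forall {x : H} (h : ∀ y, l (x * y) = 0) : x = 0 := by
  obtain ⟨x, rfl⟩ := hl.antipode_surjective x
  have h0 : l ∘ₗ LinearMap.mulLeft k (antipode k x) = 0 := LinearMap.ext h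
  rw [← hl.hit_mulLeft x, h0]
  simp [hitLeft_apply]

/-- `l` is a right integral: `∑ l(h₁) h₂ = l(h) 1`. -/
theorem hitLeft_self (h : H) : hitLeft l h = l h • (1 : H) := by
  refine sub_eq_zero.1 ((Module.forall_dual_apply_eq_zero_iff k _).1 fun f => ?_)
  have h1 : f ∘ₗ hitLeft l = f 1 • l := by
    apply hl.dual_ext
    rw [hitLeft_comp_hitLeft, hitLeft_smul, LinearMap.smul_apply, hl.hit_eq_one, hitLeft_one]
  have h2 := LinearMap.congr_fun h1 h
  rw [LinearMap.comp_apply, LinearMap.smul_apply] at h2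
  rw [map_sub, h2, map_smul, smul_eq_mul, smul_eq_mul, mul_comm, sub_self]

theorem apply_integral : l L = 1 := by
  rw [← counit_hitLeft, hl.hit_eq_one, Bialgebra.counit_one]

theorem antipode_integral : antipode k L = L := by
  have h1 : ∀ h, antipode k L * h = counit (R := k) h • antipode k L := fun h => by
    obtain ⟨h, rfl⟩ := hl.antipode_surjective h
    rw [← antipode_mul_antidistrib, hl.integral.mul_left, map_smul, counit_antipode]
  have h2 := h1 L
  rw [hl.integral.mul_left, hl.integral.counit_eq, counit_antipode, hl.integral.counit_eq] at h2
  simpa using h2.symm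

/-- `l ∘ S` is a left integral of the dual algebra. -/
theorem hitRight_antipode (h : H) :
    hitRight (l ∘ₗ antipode k) h = l (antipode k h) • (1 : H) := by
  apply hl.antipode_injective
  rw [antipode_hitRight, hl.hitLeft_self, map_smul, antipode_one]

/-- Right integrals of the dual algebra are unique up to scalars. -/
theorem eq_smul_of_hitLeft {p : Module.Dual k H} (hp : ∀ h, hitLeft p h = p h • (1 : H)) :
    p = p L • l := by
  apply hl.dual_ext
  rw [hp, hitLeft_smul, LinearMap.smul_apply, hl.hit_eq_one]

/-- Left integrals of the dual algebra are unique up to scalars. -/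
theorem eq_smul_of_hitRight {p : Module.Dual k H} (hp : ∀ h, hitRight p h = p h • (1 : H)) :
    p = p L • (l ∘ₗ antipode k) := by
  let e := LinearEquiv.ofBijective (antipode k (A := H))
    ⟨hl.antipode_injective, hl.antipode_surjective⟩
  have hpe : p = (p ∘ₗ e.symm.toLinearMap) ∘ₗ antipode k := by
    ext x
    exact congrArg p (e.symm_apply_apply x).symm
  have h1 : ∀ h, hitLeft (p ∘ₗ e.symm.toLinearMap) h = (p ∘ₗ e.symm.toLinearMap) h • (1 : H) :=
    fun h => by
    obtain ⟨h, rfl⟩ := hl.antipode_surjective h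
    rw [← antipode_hitRight, ← hpe, hp, map_smul, antipode_one]
    congr 1
    exact LinearMap.congr_fun hpe h
  have h2 := hl.eq_smul_of_hitLeft h1
  have h3 : (p ∘ₗ e.symm.toLinearMap) L = p L := by
    conv_lhs => rw [← hl.antipode_integral]
    exact (LinearMap.congr_fun hpe L).symm
  rw [h3] at h2
  conv_lhs => rw [hpe, h2]
  rfl

/-- The distinguished element `b = ∑ l(S(Λ₁)) Λ₂` is grouplike: by uniqueness, the product of the
left integral `l ∘ S` with any functional is a multiple of `l ∘ S`. -/
theorem isGroupLikeElem : IsGroupLikeElem k (hitLeft (l ∘ₗ antipode k) L) where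
  counit_eq_one := by
    rw [counit_hitLeft, LinearMap.comp_apply, hl.antipode_integral, hl.apply_integral]
  comul_eq_tmul_self := by
    refine eq_of_lid_rTensor_eq fun f => ?_
    have h1 : ∀ h, hitRight (f ∘ₗ hitLeft (l ∘ₗ antipode k)) h =
        (f ∘ₗ hitLeft (l ∘ₗ antipode k)) h • (1 : H) := fun h => by
      rw [hitRight_comp_hitLeft, LinearMap.comp_apply, hitLeft_apply]
      generalize comul (R := k) h = T
      induction T with
      | zero => simp
      | add a b ha hb => simp only [map_add, add_smul, ha, hb]
      | tmul a b =>
        rw [TensorProduct.map_tmul, hl.hitRight_antipode]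
        simp [smul_smul, mul_comm]
    have h2 := congrArg (fun p => hitLeft p L) (hl.eq_smul_of_hitRight h1)
    simp only [hitLeft_comp_hitLeft, hitLeft_smul] at h2
    rw [← hitLeft_apply, h2]
    simp

end IsDualIntegral

end Integrals

/-! ### Traces of the square of the antipode, and the regular character -/

section TraceFormula

variable {k H : Type*} [Field k] [Ring H] [HopfAlgebra k H]

theorem apply_hitRight (p q : Module.Dual k H) (h : H) : p (hitRight q h) = q (hitLeft p h) := by
  rw [hitRight_apply, hitLeft_apply]
  generalize comul (R := k) h = T
  induction T with
  | zero => simp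
  | add a b ha hb => simp only [map_add, ha, hb]
  | tmul a b => simp [mul_comm]

theorem antipode_hitLeft (p : Module.Dual k H) (h : H) :
    antipode k (hitLeft (p ∘ₗ antipode k) h) = hitRight p (antipode k h) := by
  rw [hitRight_apply, hitLeft_apply, comul_antipode]
  generalize comul (R := k) h = T
  induction T with
  | zero => simp
  | add a b ha hb => simp only [map_add, ha, hb]
  | tmul a b => simp

variable (k H) in
/-- The square `S²` of the antipode, an algebra endomorphism. -/
noncomputable def antipodeSq : H →ₐ[k] H :=
  AlgHom.ofLinearMap (antipode k ∘ₗ antipode k) (by simp [antipode_one])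
    (fun x y => by simp [antipode_mul_antidistrib])

theorem antipodeSq_apply (h : H) : antipodeSq k H h = antipode k (antipode k h) := rfl

namespace IsDualIntegral

variable {L : H} {l : Module.Dual k H} (hl : IsDualIntegral L l)

include hl

/-- Each `h` equals `∑ l(S(h)Λ₁) Λ₂`: this writes endomorphisms of `H` as sums of operators of
rank one and so computes their traces. -/
theorem trace_mulLeft_comp_antipodeSq (x : H) :
    LinearMap.trace k H (LinearMap.mulLeft k x ∘ₗ (antipodeSq k H).toLinearMap) =
      l (antipode k x) := by
  have := hl.integral.dualToHopf_surjective_and_finite.2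
  set f := LinearMap.mulLeft k x ∘ₗ (antipodeSq k H).toLinearMap with hf
  let A : H →ₗ[k] Module.Dual k H :=
    LinearMap.lcomp k k (antipode k) ∘ₗ (LinearMap.mul k H).flip.compr₂ l
  have hA : ∀ a h, A a h = l (antipode k h * a) := fun _ _ => rfl
  have h1 : dualTensorHom k H H (TensorProduct.map A f (comul L)) = f := by
    ext h
    have h2 : ∀ T : H ⊗[k] H, dualTensorHom k H H (TensorProduct.map A f T) h =
        f (TensorProduct.lid k H
          ((l ∘ₗ LinearMap.mulLeft k (antipode k h)).rTensor H T)) := fun T => by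
      induction T with
      | zero => simp
      | add a b ha hb => simp only [map_add, LinearMap.add_apply, ha, hb]
      | tmul a b => simp [hA]
    rw [h2, ← hitLeft_apply, hl.hit_mulLeft]
  rw [← h1, LinearMap.trace_eq_contract_apply]
  have h3 : ∀ T : H ⊗[k] H, contractLeft k H (TensorProduct.map A f T) =
      l (antipode k x * LinearMap.mul' k H ((antipode k).lTensor H T)) := fun T => by
    induction T with
    | zero => simp
    | add a b ha hb => simp only [map_add, mul_add, ha, hb]
    | tmul a b =>
      simp only [TensorProduct.map_tmul, contractLeft_apply, hA, hf, LinearMap.comp_apply,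
        LinearMap.mulLeft_apply, AlgHom.toLinearMap_apply, antipodeSq_apply,
        antipode_mul_antidistrib, LinearMap.lTensor_tmul, LinearMap.mul'_apply]
      rw [← mul_assoc, hl.apply_mul_comm (antipode k x * a), mul_assoc]
  rw [h3, HopfAlgebra.mul_antipode_lTensor_comul_apply, hl.integral.counit_eq]
  simp

theorem trace_antipodeSq : LinearMap.trace k H (antipodeSq k H).toLinearMap = l 1 := by
  have := hl.trace_mulLeft_comp_antipodeSq 1
  rwa [LinearMap.mulLeft_one, LinearMap.id_comp, antipode_one] at this

/-- With `g = S(b)` for the distinguished grouplike `b`, one has `l ∘ S = l(g ·)`; comparing the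
Nakayama automorphisms of the two sides gives `S⁴(x) g = g x`. -/
theorem antipodeSq_antipodeSq_mul (x : H) :
    antipodeSq k H (antipodeSq k H x) * antipode k (hitLeft (l ∘ₗ antipode k) L) =
      antipode k (hitLeft (l ∘ₗ antipode k) L) * x := by
  set g := antipode k (hitLeft (l ∘ₗ antipode k) L)
  have hg : ∀ y, l (antipode k y) = l (g * y) := fun y =>
    LinearMap.congr_fun (hl.exists_eq_mulLeft (l ∘ₗ antipode k)) y
  rw [← sub_eq_zero]
  refine hl.eq_zero_of_forall fun y => ?_
  have h1 : l (g * (x * y)) = l (g * (y * antipodeSq k H x)) := by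
    rw [← hg, ← hg, antipode_mul_antidistrib, antipode_mul_antidistrib, hl.apply_mul_comm,
      antipodeSq_apply]
  rw [sub_mul, map_sub, mul_assoc, mul_assoc, h1, ← mul_assoc g, hl.apply_mul_comm (g * y),
    ← antipodeSq_apply, sub_self]

/-- If `l(1) ≠ 0`, the right integral `l` is also a left integral, so that the distinguished
element is trivial. -/
theorem antipodeSq_antipodeSq_of_ne_zero (h0 : l 1 ≠ 0) (x : H) :
    antipodeSq k H (antipodeSq k H x) = x := by
  have h1 : l ∘ₗ antipode k = l := by
    ext h
    have h2 := apply_hitRight l (l ∘ₗ antipode k) h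
    rw [hl.hitRight_antipode, hl.hitLeft_self, map_smul, map_smul, LinearMap.comp_apply,
      antipode_one, smul_eq_mul, smul_eq_mul] at h2
    exact mul_right_cancel₀ h0 h2
  have h3 := hl.antipodeSq_antipodeSq_mul x
  rwa [h1, hl.hit_eq_one, antipode_one, mul_one, one_mul] at h3

end IsDualIntegral

end TraceFormula

section RegularCharacter

variable {k H : Type*} [Field k] [Ring H] [HopfAlgebra k H]

/-- `hitRight p`, as a linear map in `p`. -/
noncomputable def hitRightHom : Module.Dual k H →ₗ[k] Module.End k H where
  toFun := hitRight
  map_add' p q := by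
    ext h
    simp [hitRight_apply, LinearMap.lTensor_add]
  map_smul' c p := by
    ext h
    simp [hitRight_apply, LinearMap.lTensor_smul]

variable (k H) in
/-- The character of the regular comodule, as an element of `H`: it is characterized by
`p(x) = tr(h ↦ ∑ h₁ p(h₂))` for all functionals `p`. -/
noncomputable def regularCharacter [FiniteDimensional k H] : H :=
  (Module.evalEquiv k H).symm (LinearMap.trace k H ∘ₗ hitRightHom)

variable [FiniteDimensional k H]

theorem apply_regularCharacter (p : Module.Dual k H) :
    p (regularCharacter k H) = LinearMap.trace k H (hitRight p) := by
  have := LinearMap.congr_fun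
    ((Module.evalEquiv k H).apply_symm_apply (LinearMap.trace k H ∘ₗ hitRightHom)) p
  exact this

/-- The operator `w ⊗ h ↦ ∑ w₁ ⊗ h₁ q(w₂ ⊗ h₂)`, as a linear map in `q`. -/
noncomputable def hitRightTensor :
    Module.Dual k (H ⊗[k] H) →ₗ[k] Module.End k (H ⊗[k] H) where
  toFun q := (TensorProduct.rid k (H ⊗[k] H)).toLinearMap ∘ₗ q.lTensor (H ⊗[k] H) ∘ₗ
    (TensorProduct.tensorTensorTensorComm k H H H H).toLinearMap ∘ₗ TensorProduct.map comul comul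
  map_add' p q := by
    ext a b
    simp [LinearMap.lTensor_add]
  map_smul' c p := by
    ext a b
    simp [LinearMap.lTensor_smul]

/-- The operator of a product functional `p ⊗ q` is `hitRight p ⊗ hitRight q`. -/
theorem trace_hitRightTensor (q : Module.Dual k (H ⊗[k] H)) :
    LinearMap.trace k _ (hitRightTensor q) =
      q (regularCharacter k H ⊗ₜ[k] regularCharacter k H) := by
  obtain ⟨t, rfl⟩ := (TensorProduct.dualDistribEquiv k H H).surjective q
  induction t with
  | zero => simp
  | add a b ha hb => simp only [map_add, LinearMap.add_apply, ha, hb]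
  | tmul p q =>
    have h1 : hitRightTensor (TensorProduct.dualDistribEquiv k H H (p ⊗ₜ[k] q)) =
        TensorProduct.map (hitRight p) (hitRight q) := by
      ext w h
      change TensorProduct.rid k (H ⊗[k] H)
        ((TensorProduct.dualDistrib k H H (p ⊗ₜ[k] q)).lTensor (H ⊗[k] H)
        (TensorProduct.tensorTensorTensorComm k H H H H (comul w ⊗ₜ[k] comul h))) =
        hitRight p w ⊗ₜ[k] hitRight q h
      rw [hitRight_apply, hitRight_apply]
      generalize comul (R := k) w = W
      generalize comul (R := k) h = T
      induction W with
      | zero => simp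
      | add a b ha hb => simp only [map_add, TensorProduct.add_tmul, ha, hb]
      | tmul a b =>
        induction T with
        | zero => simp
        | add a b ha hb => simp only [map_add, TensorProduct.tmul_add, ha, hb]
        | tmul c d => simp [TensorProduct.smul_tmul', TensorProduct.tmul_smul, smul_smul, mul_comm]
    rw [h1, LinearMap.trace_tensorProduct', ← apply_regularCharacter, ← apply_regularCharacter]
    exact (TensorProduct.dualDistrib_apply _ _ _ _).symm

variable (k H) in
/-- The Galois map `w ⊗ h ↦ ∑ w₁ ⊗ w₂ h`. -/
noncomputable def galoisMap : H ⊗[k] H →ₗ[k] H ⊗[k] H :=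
  LinearMap.mul' k (H ⊗[k] H) ∘ₗ TensorProduct.map comul
    (Algebra.TensorProduct.includeRight : H →ₐ[k] H ⊗[k] H).toLinearMap

omit [FiniteDimensional k H] in
theorem galoisMap_tmul (w h : H) :
    galoisMap k H (w ⊗ₜ h) = comul w * ((1 : H) ⊗ₜ[k] h) := by
  simp [galoisMap]

omit [FiniteDimensional k H] in
theorem galoisMap_surjective : Function.Surjective (galoisMap k H) := fun T => by
  induction T with
  | zero => exact ⟨0, map_zero _⟩
  | add a b ha hb =>
    obtain ⟨x, rfl⟩ := ha
    obtain ⟨y, rfl⟩ := hb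
    exact ⟨x + y, map_add _ _ _⟩
  | tmul w h =>
    refine ⟨(antipode k).lTensor H (comul w) * ((1 : H) ⊗ₜ[k] h), ?_⟩
    have h1 : ∀ T : H ⊗[k] H, galoisMap k H ((antipode k).lTensor H T * ((1 : H) ⊗ₜ[k] h)) =
        LinearMap.mul' k (H ⊗[k] H) (TensorProduct.map (comul (R := k))
        ((Algebra.TensorProduct.includeRight : H →ₐ[k] H ⊗[k] H).toLinearMap ∘ₗ antipode k) T) *
        ((1 : H) ⊗ₜ[k] h) := fun T => by
      induction T with
      | zero => simp
      | add a b ha hb => simp only [map_add, add_mul, ha, hb]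
      | tmul a b => simp [galoisMap_tmul, mul_assoc]
    rw [h1, comul_mul_one_tmul_antipode]
    simp

omit [FiniteDimensional k H] in
/-- The Galois map intertwines the diagonal coaction on `H ⊗ H` with the coaction on the second
factor. -/
theorem galoisMap_hitRightTensor (p : Module.Dual k H) (z : H ⊗[k] H) :
    galoisMap k H (hitRightTensor (p ∘ₗ LinearMap.mul' k H) z) =
      (hitRight p).lTensor H (galoisMap k H z) := by
  induction z with
  | zero => simp
  | add a b ha hb => simp only [map_add, ha, hb]
  | tmul w h =>
    let Γ : H ⊗[k] H → H ⊗[k] (H ⊗[k] H) →ₗ[k] H ⊗[k] H := fun T =>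
      ((TensorProduct.rid k H).toLinearMap ∘ₗ p.lTensor H ∘ₗ LinearMap.mulRight k T).lTensor H
    have hΓ : ∀ S T U, Γ (S + T) U = Γ S U + Γ T U := fun S T U => by
      simp only [Γ]
      rw [← LinearMap.add_apply, ← LinearMap.lTensor_add]
      congr 2
      ext x y
      simp [mul_add]
    have h1 : ∀ W T : H ⊗[k] H, galoisMap k H (TensorProduct.rid k (H ⊗[k] H)
        ((p ∘ₗ LinearMap.mul' k H).lTensor (H ⊗[k] H)
        (TensorProduct.tensorTensorTensorComm k H H H H (W ⊗ₜ[k] T)))) =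
        Γ T (TensorProduct.assoc k H H H ((comul (R := k)).rTensor H W)) := fun W T => by
      induction W with
      | zero => simp
      | add a b ha hb => simp only [map_add, TensorProduct.add_tmul, ha, hb]
      | tmul a b =>
        induction T with
        | zero => simp [Γ]
        | add a b ha hb => simp only [map_add, TensorProduct.tmul_add, ha, hb, hΓ]
        | tmul c d =>
          simp only [TensorProduct.tensorTensorTensorComm_tmul, LinearMap.lTensor_tmul,
            TensorProduct.rid_tmul, map_smul, galoisMap_tmul, LinearMap.rTensor_tmul]
          generalize comul (R := k) a = V
          induction V with
          | zero => simp
          | add a b ha hb => simp only [map_add, TensorProduct.add_tmul, add_mul, smul_add, ha, hb]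
          | tmul e f => simp [Γ, TensorProduct.tmul_smul]
    have h2 : ∀ W : H ⊗[k] H, (hitRight p).lTensor H (W * ((1 : H) ⊗ₜ[k] h)) =
        Γ (comul h) ((comul (R := k)).lTensor H W) := fun W => by
      induction W with
      | zero => simp
      | add a b ha hb => simp only [map_add, add_mul, ha, hb]
      | tmul a b => simp [Γ, hitRight_apply]
    rw [galoisMap_tmul, h2, ← Coalgebra.coassoc_apply, ← h1]
    rfl

/-- `x² = (dim H) x` for the regular character `x`: the tensor square of the regular comodule is
free, the map `w ⊗ h ↦ ∑ w₁ ⊗ w₂ h` making the coaction on the first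
factor trivial. -/
theorem regularCharacter_mul_self :
    regularCharacter k H * regularCharacter k H =
      (Module.finrank k H : k) • regularCharacter k H := by
  rw [← sub_eq_zero]
  refine (Module.forall_dual_apply_eq_zero_iff k _).1 fun p => ?_
  let e := LinearEquiv.ofBijective (galoisMap k H)
    ⟨LinearMap.injective_iff_surjective.2 galoisMap_surjective, galoisMap_surjective⟩
  have h1 : e.conj (hitRightTensor (p ∘ₗ LinearMap.mul' k H)) = (hitRight p).lTensor H := by
    refine LinearMap.ext fun z => ?_
    obtain ⟨z, rfl⟩ := e.surjective z
    rw [LinearEquiv.conj_apply_apply, e.symm_apply_apply]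
    exact galoisMap_hitRightTensor p z
  have h2 := LinearMap.trace_conj' (hitRightTensor (p ∘ₗ LinearMap.mul' k H)) e
  rw [h1, trace_hitRightTensor, LinearMap.lTensor, LinearMap.trace_tensorProduct',
    LinearMap.trace_id, ← apply_regularCharacter, LinearMap.comp_apply, LinearMap.mul'_apply] at h2
  rw [map_sub, map_smul, smul_eq_mul, h2, sub_self]

variable {L : H} {l : Module.Dual k H} (hl : IsDualIntegral L l)

include hl

theorem IsDualIntegral.antipodeSq_regularCharacter :
    antipodeSq k H (regularCharacter k H) = regularCharacter k H := by
  rw [← sub_eq_zero]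
  refine (Module.forall_dual_apply_eq_zero_iff k _).1 fun p => ?_
  let e := LinearEquiv.ofBijective (antipodeSq k H).toLinearMap
    ⟨hl.antipode_injective.comp hl.antipode_injective,
      hl.antipode_surjective.comp hl.antipode_surjective⟩
  have h1 : e.conj (hitRight ((p ∘ₗ antipode k) ∘ₗ antipode k)) = hitRight p := by
    refine LinearMap.ext fun z => ?_
    obtain ⟨z, rfl⟩ := e.surjective z
    rw [LinearEquiv.conj_apply_apply, e.symm_apply_apply]
    change antipode k (antipode k _) = hitRight p (antipode k (antipode k z))
    rw [antipode_hitRight, antipode_hitLeft]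
  rw [map_sub, apply_regularCharacter p, ← h1, LinearMap.trace_conj', ← apply_regularCharacter]
  exact sub_self _

theorem IsDualIntegral.apply_antipode_regularCharacter :
    l (antipode k (regularCharacter k H)) = l 1 := by
  have h1 : hitRight (l ∘ₗ antipode k) = (l ∘ₗ antipode k).smulRight (1 : H) := by
    ext h
    rw [hl.hitRight_antipode]
    rfl
  rw [← LinearMap.comp_apply, apply_regularCharacter, h1, LinearMap.trace_smulRight,
    LinearMap.comp_apply, antipode_one]

end RegularCharacter

/-! ### Traces of involutions and of endomorphisms of finite order -/

section Involutions

variable {k V : Type*} [Field k] [CharZero k] [AddCommGroup V] [Module k V] [FiniteDimensional k V]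

omit [CharZero k] in
theorem trace_eq_finrank_range_of_idempotent {P : Module.End k V} (hP : P * P = P) :
    LinearMap.trace k V P = (Module.finrank k (LinearMap.range P) : k) :=
  (LinearMap.IsIdempotentElem.isProj_range P hP).trace

theorem exists_int_trace_of_cube_eq {B : Module.End k V} (hB : B * B * B = B) :
    ∃ z : ℤ, LinearMap.trace k V B = z := by
  have h2 : (2 : k) ≠ 0 := two_ne_zero
  -- `B = P - Q` with the idempotents `P = (B² + B)/2` and `Q = (B² - B)/2`.
  have h4' : B * B * (B * B) = B * B := by rw [← mul_assoc, hB]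
  have h3' : B * (B * B) = B := by rw [← mul_assoc, hB]
  have hP := trace_eq_finrank_range_of_idempotent (P := (2⁻¹ : k) • (B * B + B)) (by
    rw [smul_mul_smul_comm, add_mul, mul_add, mul_add, h4', h3', hB,
      show B * B + B + (B + B * B) = (2 : k) • (B * B + B) by rw [two_smul]; abel, smul_smul]
    congr 1
    field_simp)
  have hQ := trace_eq_finrank_range_of_idempotent (P := (2⁻¹ : k) • (B * B - B)) (by
    rw [smul_mul_smul_comm, sub_mul, mul_sub, mul_sub, h4', h3', hB,
      show B * B - B - (B - B * B) = (2 : k) • (B * B - B) by rw [two_smul]; abel, smul_smul]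
    congr 1
    field_simp)
  refine ⟨Module.finrank k (LinearMap.range ((2⁻¹ : k) • (B * B + B))) -
    Module.finrank k (LinearMap.range ((2⁻¹ : k) • (B * B - B))), ?_⟩
  push_cast
  rw [← hP, ← hQ, ← map_sub, ← smul_sub,
    show B * B + B - (B * B - B) = (2 : k) • B by rw [two_smul]; abel, smul_smul,
    inv_mul_cancel₀ h2, one_smul]

/-- The trace of an involution `T` of an `n`-dimensional space lies in `{-n, ..., n}`; a fixed
vector excludes `-n`. -/
theorem eq_one_of_trace_eq_finrank_mul {T : Module.End k V} (hT : T * T = 1) {v : V} (hv : v ≠ 0)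
    (hTv : T v = v) (h0 : LinearMap.trace k V T ≠ 0) {z : ℤ}
    (hz : LinearMap.trace k V T = Module.finrank k V * z) : T = 1 := by
  have h2 : (2 : k) ≠ 0 := two_ne_zero
  set P : Module.End k V := (2⁻¹ : k) • (1 + T) with hPdef
  set Q : Module.End k V := (2⁻¹ : k) • (1 - T) with hQdef
  have hP := trace_eq_finrank_range_of_idempotent (P := P) (by
    rw [hPdef, smul_mul_smul_comm, add_mul, mul_add, mul_add, hT, mul_one, one_mul, mul_one,
      show 1 + T + (T + 1) = (2 : k) • (1 + T) by rw [two_smul]; abel, smul_smul]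
    congr 1
    field_simp)
  have hQ := trace_eq_finrank_range_of_idempotent (P := Q) (by
    rw [hQdef, smul_mul_smul_comm, sub_mul, mul_sub, mul_sub, hT, mul_one, one_mul, mul_one,
      show 1 - T - (T - 1) = (2 : k) • (1 - T) by rw [two_smul]; abel, smul_smul]
    congr 1
    field_simp)
  set a := Module.finrank k (LinearMap.range P)
  set b := Module.finrank k (LinearMap.range Q) with hb
  have hsum : P + Q = 1 := by
    rw [hPdef, hQdef, ← smul_add, show 1 + T + (1 - T) = (2 : k) • (1 : Module.End k V) by
      rw [two_smul]; abel, smul_smul, inv_mul_cancel₀ h2, one_smul]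
  have hdiff : P - Q = T := by
    rw [hPdef, hQdef, ← smul_sub, show 1 + T - (1 - T) = (2 : k) • T by
      rw [two_smul]; abel, smul_smul, inv_mul_cancel₀ h2, one_smul]
  have hn : a + b = Module.finrank k V := by
    have := LinearMap.trace_one k V
    rw [← hsum, map_add, hP, hQ] at this
    exact_mod_cast this
  have hd : (a : ℤ) - b = Module.finrank k V * z := by
    rw [← hdiff, map_sub, hP, hQ] at hz
    exact_mod_cast hz
  have ha : 0 < a := by
    refine Module.finrank_pos_iff_exists_ne_zero.2 ⟨⟨v, v, ?_⟩, fun h => hv (congrArg Subtype.val h)⟩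
    rw [hPdef, LinearMap.smul_apply, LinearMap.add_apply, hTv, Module.End.one_apply, ← two_smul k,
      smul_smul, inv_mul_cancel₀ h2, one_smul]
  have hz0 : z ≠ 0 := by
    rintro rfl
    exact h0 (by simpa using hz)
  have hb0 : b = 0 := by
    by_contra hb0
    have hbpos : 0 < b := Nat.pos_of_ne_zero hb0
    rw [← hn] at hd
    push_cast at hd
    rcases lt_or_gt_of_ne hz0 with h | h
    · nlinarith
    · nlinarith
  have hQ0 : Q = 0 := by
    rw [hb, Submodule.finrank_eq_zero, LinearMap.range_eq_bot] at hb0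
    exact hb0
  rw [← hdiff, ← hsum, hQ0, sub_zero, add_zero]

end Involutions

section RootsOfUnity

variable {k V : Type*} [Field k] [IsAlgClosed k] [CharZero k] [AddCommGroup V] [Module k V]
  [FiniteDimensional k V]

open Polynomial in
/-- An endomorphism of finite order is diagonalizable; its trace and the trace of its inverse are
computed on the same eigenspaces. -/
theorem exists_trace_eq_sum_rootsOfUnity {f g : Module.End k V} {N : ℕ} (hN : 0 < N)
    (hf : f ^ N = 1) (hgf : g * f = 1) :
    ∃ (s : Finset k) (m : k → ℕ), (∀ ζ ∈ s, ζ ^ N = 1) ∧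
      LinearMap.trace k V f = ∑ ζ ∈ s, (m ζ : k) * ζ ∧
      LinearMap.trace k V g = ∑ ζ ∈ s, (m ζ : k) * ζ⁻¹ := by
  classical
  have hss : f.IsSemisimple := by
    refine Module.End.isSemisimple_of_squarefree_aeval_eq_zero (p := X ^ N - C (1 : k)) ?_ ?_
    · exact (separable_X_pow_sub_C (1 : k) (by exact_mod_cast hN.ne') one_ne_zero).squarefree
    · simp [hf]
  have hint : DirectSum.IsInternal f.eigenspace :=
    (DirectSum.isInternal_submodule_iff_iSupIndep_and_iSup_eq_top _).2
      ⟨f.eigenspaces_iSupIndep, hss.iSup_eigenspace_eq_top⟩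
  have hfin : {ζ | f.eigenspace ζ ≠ ⊥}.Finite :=
    WellFoundedGT.finite_ne_bot_of_iSupIndep f.eigenspaces_iSupIndep
  have hmem : ∀ ζ, f.eigenspace ζ ≠ ⊥ → ζ ^ N = 1 := fun ζ hζ => by
    obtain ⟨v, hv, hv0⟩ := Submodule.exists_mem_ne_zero_of_ne_bot hζ
    have h1 : (f ^ N) v = ζ ^ N • v := by
      have := Module.End.HasEigenvector.pow_apply (f := f) (μ := ζ) ⟨hv, hv0⟩ N
      exact this
    rw [hf, Module.End.one_apply] at h1
    by_contra hne
    have h2 : (ζ ^ N - 1) • v = 0 := by rw [sub_smul, ← h1, one_smul, sub_self]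
    exact (smul_eq_zero.1 h2).elim (fun h => hne (sub_eq_zero.1 h)) hv0
  have hfm : ∀ ζ, Set.MapsTo f (f.eigenspace ζ) (f.eigenspace ζ) := fun ζ v hv => by
    have hv' := Module.End.mem_eigenspace_iff.1 hv
    rw [hv']
    exact Submodule.smul_mem _ _ hv
  have hgv : ∀ ζ, ∀ v ∈ f.eigenspace ζ, g v = ζ⁻¹ • v := fun ζ v hv => by
    have hv' := Module.End.mem_eigenspace_iff.1 hv
    by_cases hbot : f.eigenspace ζ = ⊥
    · rw [hbot, Submodule.mem_bot] at hv
      simp [hv]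
    · have hζ : ζ ≠ 0 := by
        rintro rfl
        simpa [hN.ne'] using hmem 0 hbot
      have h1 : g (f v) = v := LinearMap.congr_fun hgf v
      rw [hv', map_smul] at h1
      nth_rewrite 2 [← h1]
      rw [smul_smul, inv_mul_cancel₀ hζ, one_smul]
  have hgm : ∀ ζ, Set.MapsTo g (f.eigenspace ζ) (f.eigenspace ζ) := fun ζ v hv => by
    rw [hgv ζ v hv]
    exact Submodule.smul_mem _ _ hv
  refine ⟨hfin.toFinset, fun ζ => Module.finrank k (f.eigenspace ζ),
    fun ζ hζ => hmem ζ (hfin.mem_toFinset.1 hζ), ?_, ?_⟩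
  · rw [LinearMap.trace_eq_sum_trace_restrict' hint hfin hfm]
    refine Finset.sum_congr rfl fun ζ _ => ?_
    have : f.restrict (hfm ζ) = ζ • LinearMap.id := by
      ext v
      exact Module.End.mem_eigenspace_iff.1 v.2
    rw [this, map_smul, LinearMap.trace_id, smul_eq_mul, mul_comm]
  · rw [LinearMap.trace_eq_sum_trace_restrict' hint hfin hgm]
    refine Finset.sum_congr rfl fun ζ _ => ?_
    have : g.restrict (hgm ζ) = ζ⁻¹ • LinearMap.id := by
      ext v
      exact hgv ζ v v.2
    rw [this, map_smul, LinearMap.trace_id, smul_eq_mul, mul_comm]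

/-- If a power of `f` is a nonzero scalar, then `tr(f) tr(f⁻¹)` is an algebraic number which every
complex embedding maps to a nonnegative real: there it is `|tr|²` of a rescaling of `f`. -/
theorem exists_trace_mul_trace_inv_nonneg (φ : algebraicClosure ℚ k →ₐ[ℚ] ℂ)
    {f g : Module.End k V} {N : ℕ} (hN : 0 < N) {c : k} (hc : c ≠ 0)
    (hf : f ^ N = c • 1) (hgf : g * f = 1) :
    ∃ w : algebraicClosure ℚ k, (w : k) = LinearMap.trace k V f * LinearMap.trace k V g ∧
      ∃ r : ℝ, 0 ≤ r ∧ φ w = r := by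
  obtain ⟨s, hs⟩ := IsAlgClosed.exists_pow_nat_eq c hN
  have hs0 : s ≠ 0 := by
    rintro rfl
    rw [zero_pow hN.ne'] at hs
    exact hc hs.symm
  obtain ⟨S, m, hS, htf, htg⟩ := exists_trace_eq_sum_rootsOfUnity (f := s⁻¹ • f) (g := s • g) hN
    (by rw [smul_pow, hf, smul_smul, inv_pow, hs, inv_mul_cancel₀ hc, one_smul])
    (by rw [smul_mul_smul_comm, hgf, mul_inv_cancel₀ hs0, one_smul])
  have hprod : LinearMap.trace k V f * LinearMap.trace k V g =
      (∑ ζ ∈ S, (m ζ : k) * ζ) * ∑ ζ ∈ S, (m ζ : k) * ζ⁻¹ := by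
    rw [← htf, ← htg, map_smul, map_smul, smul_eq_mul, smul_eq_mul]
    field_simp
  have hint : ∀ ζ ∈ S, ζ ∈ algebraicClosure ℚ k := fun ζ hζ => by
    rw [mem_algebraicClosure_iff]
    have h1 : IsIntegral ℚ (ζ ^ N) := by rw [hS ζ hζ]; exact isIntegral_one
    exact (h1.of_pow hN).isAlgebraic
  let a : algebraicClosure ℚ k :=
    ∑ ζ ∈ S.attach, (m ζ : algebraicClosure ℚ k) * ⟨ζ, hint ζ ζ.2⟩
  let b : algebraicClosure ℚ k :=
    ∑ ζ ∈ S.attach, (m ζ : algebraicClosure ℚ k) * (⟨ζ, hint ζ ζ.2⟩ : algebraicClosure ℚ k)⁻¹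
  refine ⟨a * b, ?_, Complex.normSq (φ a), Complex.normSq_nonneg _, ?_⟩
  · rw [hprod, ← Finset.sum_attach S, ← Finset.sum_attach S fun ζ => (m ζ : k) * ζ⁻¹]
    simp [a, b]
  · have hb : φ b = (starRingEnd ℂ) (φ a) := by
      simp only [a, b, map_sum, map_mul, map_natCast, map_inv₀]
      refine Finset.sum_congr rfl fun ζ _ => ?_
      congr 1
      apply Complex.inv_eq_conj
      refine Complex.norm_eq_one_of_pow_eq_one (n := N) ?_ hN.ne'
      rw [← map_pow, ← map_one φ]
      congr 1
      apply Subtype.ext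
      simpa using hS ζ ζ.2
    rw [map_mul, hb, Complex.mul_conj]

/-- A sum of products `tr(fᵢ) tr(fᵢ⁻¹)` as in `exists_trace_mul_trace_inv_nonneg` vanishes only if
every summand does. -/
theorem trace_mul_trace_inv_eq_zero_of_sum {ι : Type*} [Fintype ι] {V : ι → Type*}
    [∀ i, AddCommGroup (V i)] [∀ i, Module k (V i)] [∀ i, FiniteDimensional k (V i)]
    {f g : ∀ i, Module.End k (V i)} {N : ℕ} (hN : 0 < N) {c : ι → k} (hc : ∀ i, c i ≠ 0)
    (hf : ∀ i, f i ^ N = c i • 1) (hgf : ∀ i, g i * f i = 1)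
    (hsum : ∑ i, LinearMap.trace k (V i) (f i) * LinearMap.trace k (V i) (g i) = 0) (i : ι) :
    LinearMap.trace k (V i) (f i) * LinearMap.trace k (V i) (g i) = 0 := by
  have : Algebra.IsAlgebraic ℚ (algebraicClosure ℚ k) := by
    convert algebraicClosure.isAlgebraic ℚ k
    · rfl
    · exact Subsingleton.elim _ _
  let φ : algebraicClosure ℚ k →ₐ[ℚ] ℂ := IsAlgClosed.lift
  choose w hw r hr hφ using fun i =>
    exists_trace_mul_trace_inv_nonneg φ hN (hc i) (hf i) (hgf i)
  have hw0 : ∑ i, w i = 0 := by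
    apply Subtype.ext
    push_cast
    simpa [hw] using hsum
  have hr0 : ∑ i, r i = 0 := by
    have h1 := congrArg φ hw0
    rw [map_sum, map_zero] at h1
    simp only [hφ] at h1
    exact_mod_cast h1
  have hri := (Finset.sum_eq_zero_iff_of_nonneg fun i _ => hr i).1 hr0 i (Finset.mem_univ i)
  have hwi : w i = 0 := by
    apply φ.toRingHom.injective
    change φ (w i) = φ 0
    rw [hφ, hri, map_zero, Complex.ofReal_zero]
  rw [← hw, hwi]
  rfl

end RootsOfUnity

/-! ### Semisimple Hopf algebras are involutory -/

section MatrixTraces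

variable {k : Type*} [Field k] {ι : Type*} [Fintype ι] {d : ι → ℕ}

theorem trace_mul_mul_pi_matrix (A B : Π i, Matrix (Fin (d i)) (Fin (d i)) k) :
    LinearMap.trace k (Π i, Matrix (Fin (d i)) (Fin (d i)) k)
      (LinearMap.mulLeft k A ∘ₗ LinearMap.mulRight k B) =
      ∑ i, (A i).trace * (B i).trace := by
  classical
  let b := Pi.basis fun i => Matrix.stdBasis k (Fin (d i)) (Fin (d i))
  rw [LinearMap.trace_eq_matrix_trace k b, Matrix.trace]
  rw [Fintype.sum_sigma]
  refine Finset.sum_congr rfl fun i _ => ?_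
  rw [Fintype.sum_prod_type, Matrix.trace, Matrix.trace, Finset.sum_mul_sum]
  refine Finset.sum_congr rfl fun a _ => Finset.sum_congr rfl fun c _ => ?_
  rw [Matrix.diag_apply, LinearMap.toMatrix_apply]
  simp [b, Pi.basis_repr, Matrix.stdBasis, Matrix.mul_apply, Pi.single_apply, ite_apply]

/-- The sum of the traces of the components is a nondegenerate form. -/
theorem eq_zero_of_forall_sum_trace {X : Π i, Matrix (Fin (d i)) (Fin (d i)) k}
    (h : ∀ Y : Π i, Matrix (Fin (d i)) (Fin (d i)) k, ∑ i, (X i * Y i).trace = 0) : X = 0 := by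
  classical
  funext i
  refine Matrix.ext_iff_trace_mul_right.2 fun M => ?_
  have h1 := h (Pi.single i M)
  rw [Finset.sum_eq_single i (fun j _ hj => by simp [Pi.single_eq_of_ne hj]) (by simp)] at h1
  simpa using h1

end MatrixTraces

theorem IsGroupLikeElem.exists_pow_eq_one {k H : Type*} [Field k] [Ring H] [HopfAlgebra k H]
    [FiniteDimensional k H] {b : H} (hb : IsGroupLikeElem k b) : ∃ m, 0 < m ∧ b ^ m = 1 := by
  have : Finite (GroupLike k H) := (linearIndep_groupLikeVal (R := k) (A := H)).finite
  have h1 := pow_orderOf_eq_one (⟨b, hb⟩ : GroupLike k H)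
  exact ⟨_, orderOf_pos (⟨b, hb⟩ : GroupLike k H), congrArg GroupLike.val h1⟩

section Involutory

variable {k H : Type*} [Field k] [Ring H] [HopfAlgebra k H] {L : H} {l : Module.Dual k H}

/-- Comparing the Frobenius form `l` with a nondegenerate symmetric form `t`, so that `l = t(u ·)`,
shows that `S²` is inner. -/
theorem exists_conj_of_isDualIntegral (hl : IsDualIntegral L l) {t : Module.Dual k H}
    [FiniteDimensional k H]
    (ht : ∀ x y, t (x * y) = t (y * x)) (hnd : ∀ x, (∀ y, t (x * y) = 0) → x = 0) :
    ∃ u w : H, w * u = 1 ∧ ∀ h, antipodeSq k H h = w * h * u := by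
  let F : H →ₗ[k] Module.Dual k H := (LinearMap.mul k H).compr₂ t
  have hF : ∀ x y, F x y = t (x * y) := fun _ _ => rfl
  have hinj : Function.Injective F := (injective_iff_map_eq_zero F).2 fun x hx =>
    hnd x fun y => LinearMap.congr_fun hx y
  have hsurj : Function.Surjective F :=
    (LinearMap.injective_iff_surjective_of_finrank_eq_finrank
      Subspace.dual_finrank_eq.symm).1 hinj
  obtain ⟨u, hu⟩ := hsurj l
  have hlu : ∀ y, l y = t (u * y) := fun y => (LinearMap.congr_fun hu y).symm
  have hinj' : ∀ x y, (∀ z, t (x * z) = t (y * z)) → x = y := fun x y h =>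
    hinj (LinearMap.ext h)
  obtain ⟨w, hw⟩ : ∃ w, u * w = 1 := by
    refine ⟨antipode k (hitLeft t L), hinj' _ _ fun z => ?_⟩
    have := LinearMap.congr_fun (hl.exists_eq_mulLeft t) z
    rw [one_mul, this, mul_assoc, ← hlu]
    rfl
  have hwu : w * u = 1 := by
    have h1 : Function.Surjective (LinearMap.mulLeft k u) := fun x =>
      ⟨w * x, by rw [LinearMap.mulLeft_apply, ← mul_assoc, hw, one_mul]⟩
    apply LinearMap.injective_iff_surjective.2 h1
    rw [LinearMap.mulLeft_apply, LinearMap.mulLeft_apply, ← mul_assoc, hw, one_mul, mul_one]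
  refine ⟨u, w, hwu, fun h => ?_⟩
  have h1 : h * u = u * antipodeSq k H h := hinj' _ _ fun x => by
    have := hl.apply_mul_comm x h
    rw [hlu, hlu, ← mul_assoc, ht, ← mul_assoc, ← antipodeSq_apply, ← mul_assoc] at this
    exact this
  rw [mul_assoc, h1, ← mul_assoc, hwu, one_mul]

/-- `tr(S²) ≠ 0`: on each matrix block, `S²` is conjugation by a matrix which has a scalar power,
so that every block contributes a nonnegative amount. They cannot all vanish since the same
contributions, weighted by the scalars by which `Λ` acts, sum to `tr(Λ S²) = 1`. -/
theorem IsDualIntegral.apply_one_ne_zero [IsAlgClosed k] [CharZero k] [IsSemisimpleRing H]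
    (hl : IsDualIntegral L l) : l 1 ≠ 0 := by
  intro h0
  have := hl.integral.dualToHopf_surjective_and_finite.2
  obtain ⟨n, d, hd, ⟨e⟩⟩ := IsSemisimpleRing.exists_algEquiv_pi_matrix_of_isAlgClosed k H
  let t : Module.Dual k H :=
    (∑ i, Matrix.traceLinearMap (Fin (d i)) k k ∘ₗ LinearMap.proj i) ∘ₗ e.toLinearMap
  have ht : ∀ x, t x = ∑ i, (e x i).trace := fun x => by simp [t]
  obtain ⟨u, w, hwu, hconj⟩ := exists_conj_of_isDualIntegral hl (t := t)
    (fun x y => by simp [ht, Matrix.trace_mul_comm (e x _)])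
    (fun x hx => by
      apply e.injective
      rw [map_zero]
      refine eq_zero_of_forall_sum_trace fun Y => ?_
      have := hx (e.symm Y)
      rw [ht] at this
      simpa using this)
  have htrace : ∀ x, LinearMap.trace k H
      (LinearMap.mulLeft k x ∘ₗ (antipodeSq k H).toLinearMap) =
      ∑ i, (e x i * e w i).trace * (e u i).trace := fun x => by
    have h1 : e.toLinearEquiv.conj (LinearMap.mulLeft k x ∘ₗ (antipodeSq k H).toLinearMap) =
        LinearMap.mulLeft k (e x * e w) ∘ₗ LinearMap.mulRight k (e u) := by
      refine LinearMap.ext fun z => ?_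
      obtain ⟨z, rfl⟩ := e.surjective z
      simp [LinearEquiv.conj_apply, hconj, mul_assoc]
    rw [← LinearMap.trace_conj' _ e.toLinearEquiv, h1, trace_mul_mul_pi_matrix]
    rfl
  -- Central elements act by a scalar on each block.
  have hscal : ∀ z : H, (∀ h, h * z = z * h) → ∀ i, ∃ c : k, e z i = c • 1 := fun z hz i => by
    have h1 : e z i ∈ Subalgebra.center k (Matrix (Fin (d i)) (Fin (d i)) k) := by
      rw [Subalgebra.mem_center_iff]
      intro M
      have h2 := congrArg (fun x => e x i) (hz (e.symm (Pi.single i M)))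
      simpa using h2
    obtain ⟨c, hc⟩ := Algebra.IsCentral.mem_center_iff k |>.1 h1
    exact ⟨c, hc.trans (Algebra.algebraMap_eq_smul_one c)⟩
  set b := hitLeft (l ∘ₗ antipode k) L
  set g := antipode k b
  have hb : IsGroupLikeElem k b := hl.isGroupLikeElem
  have hgb : g * b = 1 := hb.antipode_mul_cancel
  have huw : u * w = 1 := by
    have h1 : Function.Surjective (LinearMap.mulLeft k w) := fun x =>
      ⟨u * x, by rw [LinearMap.mulLeft_apply, ← mul_assoc, hwu, one_mul]⟩
    apply LinearMap.injective_iff_surjective.2 h1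
    rw [LinearMap.mulLeft_apply, LinearMap.mulLeft_apply, ← mul_assoc, hwu, one_mul, mul_one]
  set z := u * u * g with hz
  have hzc : ∀ h, h * z = z * h := fun h => by
    have h1 := hl.antipodeSq_antipodeSq_mul h
    rw [hconj, hconj] at h1
    change w * (w * h * u) * u * g = g * h at h1
    calc h * z = u * (u * w) * w * h * u * u * g := by rw [huw, mul_one, huw, one_mul, hz]; noncomm_ring
      _ = u * u * ((w * (w * h * u) * u) * g) := by noncomm_ring
      _ = z * h := by rw [h1, hz]; simp only [mul_assoc]
  obtain ⟨m, hm, hbm⟩ := IsGroupLikeElem.exists_pow_eq_one hb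
  have hu2 : u ^ 2 = z * b := by rw [hz, mul_assoc, hgb, mul_one, sq]
  have huN : u ^ (2 * m) = z ^ m := by
    rw [pow_mul, hu2, Commute.mul_pow (hzc b).symm, hbm, mul_one]
  choose c hc using hscal z hzc
  have huNi : ∀ i, e u i ^ (2 * m) = c i ^ m • 1 := fun i => by
    have h1 := congrArg (fun x => e x i) huN
    simp only [map_pow, Pi.pow_apply, hc, smul_pow, one_pow] at h1
    exact h1
  have hwui : ∀ i, e w i * e u i = 1 := fun i => by
    have h1 := congrArg (fun x => e x i) hwu
    simpa using h1
  have huwi : ∀ i, e u i * e w i = 1 := fun i => by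
    have h1 := congrArg (fun x => e x i) huw
    simpa using h1
  have hci : ∀ i, c i ^ m ≠ 0 := fun i h => by
    have h1 := huNi i
    rw [h, zero_smul] at h1
    have h2 : IsUnit (e u i) := ⟨⟨e u i, e w i, huwi i, hwui i⟩, rfl⟩
    exact (h2.pow (2 * m)).ne_zero h1
  have hall := trace_mul_trace_inv_eq_zero_of_sum (f := fun i => Matrix.toLin' (e u i))
    (g := fun i => Matrix.toLin' (e w i)) (N := 2 * m) (by omega) hci
    (fun i => by rw [← Matrix.toLin'_pow, huNi, map_smul, Matrix.toLin'_one]; rfl)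
    (fun i => by
      rw [Module.End.mul_eq_comp, ← Matrix.toLin'_mul, hwui, Matrix.toLin'_one]; rfl)
    (by
      have h1 := htrace 1
      rw [hl.trace_mulLeft_comp_antipodeSq, antipode_one, h0] at h1
      rw [h1]
      refine Finset.sum_congr rfl fun i _ => ?_
      simp [mul_comm])
  choose c' hc' using hscal L fun h => by rw [hl.integral.mul_left, hl.integral.mul_right]
  have h1 := htrace L
  rw [hl.trace_mulLeft_comp_antipodeSq, hl.antipode_integral, hl.apply_integral] at h1
  refine one_ne_zero (h1.trans (Finset.sum_eq_zero fun i _ => ?_))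
  have h2 := hall i
  simp only [Matrix.trace_toLin'_eq] at h2
  rw [hc', smul_mul_assoc, one_mul, Matrix.trace_smul, smul_mul_assoc, mul_comm, h2, smul_zero]

/-- **Larson–Radford**: a semisimple Hopf algebra over an algebraically closed field of
characteristic `0` is involutory. -/
theorem antipode_antipode_of_isSemisimpleRing [IsAlgClosed k] [CharZero k] [IsSemisimpleRing H]
    (h : H) : antipode k (antipode k h) = h := by
  obtain ⟨l, hl⟩ := (integral_spec k H).exists_isDualIntegral
  have := hl.integral.dualToHopf_surjective_and_finite.2
  have h0 := hl.apply_one_ne_zero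
  have h4 := hl.antipodeSq_antipodeSq_of_ne_zero h0
  set T : Module.End k H := (antipodeSq k H).toLinearMap with hT
  have hTT : T * T = 1 := LinearMap.ext h4
  have h10 : (1 : H) ≠ 0 := fun h => h0 (by rw [h, map_zero])
  have hn : (Module.finrank k H : k) ≠ 0 := by
    have : 0 < Module.finrank k H := Module.finrank_pos_iff_exists_ne_zero.2 ⟨1, h10⟩
    exact_mod_cast this.ne'
  set n : k := (Module.finrank k H : k)
  set x := regularCharacter k H with hx
  have hTx : T x = x := hl.antipodeSq_regularCharacter
  have hTmul : ∀ a b, T (a * b) = T a * T b := map_mul (antipodeSq k H)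
  set M : Module.End k H := LinearMap.mulLeft k x with hM
  have hMM : M * M = n • M := LinearMap.ext fun y => by
    simp only [hM, Module.End.mul_apply, LinearMap.mulLeft_apply, LinearMap.smul_apply]
    rw [← mul_assoc, hx, regularCharacter_mul_self, smul_mul_assoc]
  have hTM : T * M = M * T := LinearMap.ext fun y => by
    simp only [hM, Module.End.mul_apply, LinearMap.mulLeft_apply, hTmul, hTx]
  have hcube : (n⁻¹ • (M * T)) * (n⁻¹ • (M * T)) * (n⁻¹ • (M * T)) = n⁻¹ • (M * T) := by
    have h1 : M * T * (M * T) * (M * T) = (n * n) • (M * T) := by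
      calc M * T * (M * T) * (M * T) = M * (T * M) * (T * M) * T := by simp only [mul_assoc]
        _ = M * M * (T * M) * (T * T) := by
          rw [hTM]
          simp only [mul_assoc]
          rw [← mul_assoc T M, hTM]
          simp only [mul_assoc]
        _ = (n * n) • (M * T) := by
          rw [hTT, mul_one, hTM, ← mul_assoc, hMM, smul_mul_assoc, hMM, smul_smul, smul_mul_assoc]
    rw [smul_mul_smul_comm, smul_mul_smul_comm, h1, smul_smul]
    congr 1
    field_simp
  obtain ⟨z, hz⟩ := exists_int_trace_of_cube_eq hcube
  have htr : LinearMap.trace k H T = n * z := by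
    have h1 := hl.trace_mulLeft_comp_antipodeSq x
    rw [hl.apply_antipode_regularCharacter] at h1
    rw [hT, hl.trace_antipodeSq, ← h1, ← hz, map_smul, smul_eq_mul, ← mul_assoc,
      mul_inv_cancel₀ hn, one_mul]
    rfl
  have hT1 : T = 1 := eq_one_of_trace_eq_finrank_mul hTT h10 (map_one (antipodeSq k H))
    (by rw [hT, hl.trace_antipodeSq]; exact h0) htr
  exact LinearMap.congr_fun hT1 h

end Involutory

/-! ### Twisted indicators -/

section BialgEquiv

variable {k H : Type*} [Field k] [Ring H] [HopfAlgebra k H]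

open WithConv in
/-- Bialgebra automorphisms commute with the antipode: both composites are convolution inverses
of `τ`. -/
theorem map_antipode (τ : H ≃ₐc[k] H) (h : H) : τ (antipode k h) = antipode k (τ h) := by
  let t : H →ₗ[k] H := (τ : H ≃ₐ[k] H).toLinearMap
  have ht : ∀ x, t x = τ x := fun _ => rfl
  have hmul : ∀ x y, t (x * y) = t x * t y := fun x y => map_mul τ x y
  have h1 : toConv (t ∘ₗ antipode k) * toConv t = 1 := by
    apply WithConv.ext
    ext x
    rw [LinearMap.convMul_def, LinearMap.convOne_def]
    have h2 : ∀ T : H ⊗[k] H, LinearMap.mul' k H (TensorProduct.map (t ∘ₗ antipode k) t T) =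
        t (LinearMap.mul' k H ((antipode k).rTensor H T)) := fun T => by
      induction T with
      | zero => simp
      | add a b ha hb => simp only [map_add, ha, hb]
      | tmul a b => simp [hmul]
    change LinearMap.mul' k H (TensorProduct.map (t ∘ₗ antipode k) t (comul x)) = _
    rw [h2, HopfAlgebra.mul_antipode_rTensor_comul_apply, ht, AlgHomClass.commutes]
    rfl
  have h2 : toConv t * toConv (antipode k ∘ₗ t) = 1 := by
    apply WithConv.ext
    ext x
    rw [LinearMap.convMul_def, LinearMap.convOne_def]
    have h2 : ∀ T : H ⊗[k] H, LinearMap.mul' k H (TensorProduct.map t (antipode k ∘ₗ t) T) =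
        LinearMap.mul' k H ((antipode k).lTensor H (TensorProduct.map t t T)) := fun T => by
      induction T with
      | zero => simp
      | add a b ha hb => simp only [map_add, ha, hb]
      | tmul a b => simp
    have h3 : TensorProduct.map t t (comul x) = comul (t x) :=
      CoalgHomClass.map_comp_comul_apply τ x
    change LinearMap.mul' k H (TensorProduct.map t (antipode k ∘ₗ t) (comul x)) = _
    rw [h2, h3, HopfAlgebra.mul_antipode_lTensor_comul_apply, ht,
      CoalgHomClass.counit_comp_apply τ x]
    rfl
  exact congrArg (fun f => f.ofConv h) (left_inv_eq_right_inv h1 h2)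

end BialgEquiv

section Forms

variable {k V : Type*} [Field k] [AddCommGroup V] [Module k V]

theorem trace_eq_of_forall_mem_span_singleton {M : Type*} [AddCommGroup M] [Module k M]
    [FiniteDimensional k M] {x : M} (hx : x ≠ 0) {F : Module.End k M}
    (hmem : ∀ y, F y ∈ Submodule.span k {x}) {c : k} (hFx : F x = c • x) :
    LinearMap.trace k M F = c := by
  have hres : F.restrict (fun y _ => hmem y : ∀ y ∈ Submodule.span k {x}, _) =
      c • LinearMap.id := by
    refine LinearMap.ext fun y => Subtype.ext ?_
    obtain ⟨a, ha⟩ := Submodule.mem_span_singleton.1 y.2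
    change F y.1 = c • y.1
    rw [← ha, map_smul, hFx, smul_comm]
  rw [← LinearMap.trace_restrict_eq_of_forall_mem _ F hmem, hres, map_smul, LinearMap.trace_id,
    finrank_span_singleton hx, Nat.cast_one, smul_eq_mul, mul_one]

/-- The operator `β ↦ ((v, w) ↦ β (c w) (a v))` on bilinear forms has trace `tr(ac)`. -/
theorem trace_compl₁₂_comp_flip [FiniteDimensional k V] (a c : Module.End k V)
    (F : Module.End k (V →ₗ[k] V →ₗ[k] k)) (hF : ∀ β v w, F β v w = β (c w) (a v)) :
    LinearMap.trace k _ F = LinearMap.trace k V (a * c) := by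
  classical
  let b := Module.finBasis k V
  let e : (V →ₗ[k] V →ₗ[k] k) ≃ₗ[k] Matrix _ _ k := LinearMap.toMatrix₂ b b
  have h1 : ∀ M, e.conj F M =
      (LinearMap.toMatrix b b a).transpose * M.transpose * LinearMap.toMatrix b b c := fun M => by
    obtain ⟨β, rfl⟩ := e.surjective M
    have h2 : F β = (β.flip).compl₁₂ a c := by
      ext v w
      rw [hF]
      rfl
    have h3 : (e β).transpose = e β.flip := by
      ext i j
      simp [e]
    rw [LinearEquiv.conj_apply_apply, e.symm_apply_apply, h2, h3]
    exact LinearMap.toMatrix₂_compl₁₂ b b b b _ _ _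
  refine (LinearMap.trace_conj' (R := k) (M := V →ₗ[k] V →ₗ[k] k)
    (N := Matrix (Fin _) (Fin _) k) F e).symm.trans ?_
  rw [LinearMap.trace_eq_matrix_trace k (Matrix.stdBasis k _ _),
    LinearMap.trace_eq_matrix_trace k b, Module.End.mul_eq_comp, LinearMap.toMatrix_comp b b b,
    Matrix.trace, Matrix.trace, Fintype.sum_prod_type, Finset.sum_comm]
  refine Finset.sum_congr rfl fun i _ => ?_
  rw [Matrix.diag_apply, Matrix.mul_apply]
  refine Finset.sum_congr rfl fun j _ => ?_
  rw [Matrix.diag_apply, LinearMap.toMatrix_apply, h1]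
  simp [Matrix.stdBasis, Matrix.mul_apply, Pi.single_apply, ite_apply]

variable {H : Type*} [Ring H] [Algebra k H] [Module H V] [IsScalarTower k H V]

variable (k H V) in
/-- The action of `H ⊗ H` on bilinear forms by `(a ⊗ c) β (v, w) = β (a v) (c w)`. As the action
composes with the arguments it reverses products; only its linearity is recorded. -/
noncomputable def formAction :
    H ⊗[k] H →ₗ[k] Module.End k (V →ₗ[k] V →ₗ[k] k) :=
  TensorProduct.lift <| LinearMap.mk₂ k
    (fun a c =>
      { toFun := fun β => β.compl₁₂ (Algebra.lsmul k k V a) (Algebra.lsmul k k V c)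
        map_add' := fun _ _ => rfl
        map_smul' := fun _ _ => rfl })
    (fun a a' c => LinearMap.ext fun β => LinearMap.ext₂ fun v w => by
      change β ((a + a') • v) (c • w) = β (a • v) (c • w) + β (a' • v) (c • w)
      rw [add_smul, map_add, LinearMap.add_apply])
    (fun r a c => LinearMap.ext fun β => LinearMap.ext₂ fun v w => by
      change β ((r • a) • v) (c • w) = r • β (a • v) (c • w)
      rw [smul_assoc, LinearMap.map_smul, LinearMap.smul_apply])
    (fun a c c' => LinearMap.ext fun β => LinearMap.ext₂ fun v w => by
      change β (a • v) ((c + c') • w) = β (a • v) (c • w) + β (a • v) (c' • w)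
      rw [add_smul, map_add])
    (fun r a c => LinearMap.ext fun β => LinearMap.ext₂ fun v w => by
      change β (a • v) ((r • c) • w) = r • β (a • v) (c • w)
      rw [smul_assoc, map_smul])

@[simp]
theorem formAction_tmul (a c : H) (β : V →ₗ[k] V →ₗ[k] k) (v w : V) :
    formAction k V H (a ⊗ₜ c) β v w = β (a • v) (c • w) := rfl

theorem trace_formAction_comp_flip [FiniteDimensional k V] (T : H ⊗[k] H) :
    LinearMap.trace k _ (formAction k V H T ∘ₗ LinearMap.lflip.toLinearMap) =
      character k H V (LinearMap.mul' k H T) := by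
  induction T with
  | zero => simp
  | add a b ha hb => rw [map_add, LinearMap.add_comp, map_add, map_add, map_add, ha, hb]
  | tmul a c =>
    rw [trace_compl₁₂_comp_flip (Algebra.lsmul k k V a) (Algebra.lsmul k k V c) _
      (fun β v w => rfl)]
    simp [character]

end Forms

section Invariants

variable {k H : Type*} [Field k] [Ring H] [HopfAlgebra k H] (τ : H ≃ₐc[k] H)
  (V : Type*) [AddCommGroup V] [Module k V] [Module H V] [IsScalarTower k H V]

instance : IsScalarTower k H (TwistedDual τ V) where
  smul_assoc c h f := by
    apply (TwistedDual.toDual τ V).injective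
    ext v
    rw [LinearEquiv.map_smul, LinearMap.smul_apply, TwistedDual.toDual_smul_apply,
      TwistedDual.toDual_smul_apply, LinearMap.map_smul (antipode k), map_smul τ, smul_assoc,
      LinearMap.map_smul]

variable {τ V}

/-- The bilinear form `(v, w) ↦ φ(v)(w)` of an `H`-map `φ : V → V^†`. -/
noncomputable def toForm (φ : V →ₗ[H] TwistedDual τ V) : V →ₗ[k] V →ₗ[k] k :=
  (TwistedDual.toDual τ V).toLinearMap ∘ₗ φ.restrictScalars k

theorem toForm_apply (φ : V →ₗ[H] TwistedDual τ V) (v w : V) :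
    toForm φ v w = TwistedDual.toDual τ V (φ v) w := rfl

theorem toForm_smul_apply (φ : V →ₗ[H] TwistedDual τ V) (h : H) (v w : V) :
    toForm φ (h • v) w = toForm φ v (τ (antipode k h) • w) := by
  rw [toForm_apply, map_smul, TwistedDual.toDual_smul_apply, toForm_apply]

theorem toForm_injective :
    Function.Injective (toForm : (V →ₗ[H] TwistedDual τ V) → V →ₗ[k] V →ₗ[k] k) :=
  fun φ ψ h => by
    ext v
    exact (TwistedDual.toDual τ V).injective (LinearMap.congr_fun h v)

/-- The bilinear forms which come from `H`-maps `V → V^†` are those with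
`β (h v) w = β v (τ(S(h)) w)`. -/
theorem exists_toForm_eq {β : V →ₗ[k] V →ₗ[k] k}
    (hβ : ∀ (h : H) (v w : V), β (h • v) w = β v (τ (antipode k h) • w)) :
    ∃ φ : V →ₗ[H] TwistedDual τ V, toForm φ = β :=
  ⟨{ toFun := fun v => (TwistedDual.toDual τ V).symm (β v)
     map_add' := fun v w => by simp
     map_smul' := fun h v => by
      apply (TwistedDual.toDual τ V).injective
      ext w
      rw [RingHom.id_apply, TwistedDual.toDual_smul_apply, LinearEquiv.apply_symm_apply,
        LinearEquiv.apply_symm_apply, hβ] }, rfl⟩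

/-- The transpose of an `H`-map is an `H`-map; this is where `τ² = 1` and `S² = 1` enter. -/
theorem exists_toForm_eq_flip (hτ : ∀ h : H, τ (τ h) = h)
    (hS : ∀ h : H, antipode k (antipode k h) = h) (φ : V →ₗ[H] TwistedDual τ V) :
    ∃ ψ : V →ₗ[H] TwistedDual τ V, toForm ψ = (toForm φ).flip := by
  refine exists_toForm_eq fun h v w => ?_
  rw [LinearMap.flip_apply, LinearMap.flip_apply, toForm_smul_apply, ← map_antipode, hτ, hS]

variable {L : H} (hL : IsNormalizedIntegral k L)

variable (τ V L) in
/-- The averaging operator `β ↦ ((v, w) ↦ ∑ β (Λ₁ v) (τ(Λ₂) w))`. -/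
noncomputable def average : Module.End k (V →ₗ[k] V →ₗ[k] k) :=
  formAction k V H (TensorProduct.map LinearMap.id (τ : H ≃ₐ[k] H).toLinearMap (comul L))

include hL in
/-- Averaged forms come from `H`-maps. -/
theorem average_mem (β : V →ₗ[k] V →ₗ[k] k) :
    ∃ φ : V →ₗ[H] TwistedDual τ V, toForm φ = average τ V L β := by
  refine exists_toForm_eq fun h v w => ?_
  have h1 : ∀ T : H ⊗[k] H, formAction k V H
      (TensorProduct.map LinearMap.id (τ : H ≃ₐ[k] H).toLinearMap T) β (h • v) w =
      formAction k V H (TensorProduct.map LinearMap.id (τ : H ≃ₐ[k] H).toLinearMap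
        (T * (h ⊗ₜ[k] (1 : H)))) β v w := fun T => by
    induction T with
    | zero => simp
    | add a b ha hb => simp only [map_add, add_mul, LinearMap.add_apply, ha, hb]
    | tmul a c => simp [mul_smul]
  have h2 : ∀ T : H ⊗[k] H, formAction k V H
      (TensorProduct.map LinearMap.id (τ : H ≃ₐ[k] H).toLinearMap T) β v
        (τ (antipode k h) • w) =
      formAction k V H (TensorProduct.map LinearMap.id (τ : H ≃ₐ[k] H).toLinearMap
        (T * ((1 : H) ⊗ₜ[k] antipode k h))) β v w := fun T => by
    induction T with
    | zero => simp
    | add a b ha hb => simp only [map_add, add_mul, LinearMap.add_apply, ha, hb]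
    | tmul a c => simp [mul_smul]
  rw [average, h1, h2, hL.comul_mul_tmul]

include hL in
theorem average_toForm (φ : V →ₗ[H] TwistedDual τ V) : average τ V L (toForm φ) = toForm φ := by
  ext v w
  have h1 : ∀ T : H ⊗[k] H, formAction k V H
      (TensorProduct.map LinearMap.id (τ : H ≃ₐ[k] H).toLinearMap T) (toForm φ) v w =
      toForm φ v (τ (LinearMap.mul' k H ((antipode k).rTensor H T)) • w) := fun T => by
    induction T with
    | zero => simp
    | add a b ha hb => simp only [map_add, add_smul, LinearMap.add_apply, ha, hb]
    | tmul a c => simp [toForm_smul_apply, mul_smul]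
  rw [average, h1, HopfAlgebra.mul_antipode_rTensor_comul_apply, hL.counit_eq, map_one, map_one,
    one_smul]

theorem trace_average_comp_flip [FiniteDimensional k V] [IsSemisimpleRing H] :
    LinearMap.trace k _ (average τ V (integral k H) ∘ₗ LinearMap.lflip.toLinearMap) =
      indicator (character k H V) τ :=
  trace_formAction_comp_flip _

theorem bijective_of_ne_zero [FiniteDimensional k V] [IsSimpleModule H V]
    {φ : V →ₗ[H] TwistedDual τ V} (hφ : φ ≠ 0) : Function.Bijective φ := by
  have hinj := LinearMap.injective_of_ne_zero hφ
  refine ⟨hinj, ?_⟩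
  have h1 : Function.Injective ((TwistedDual.toDual τ V).toLinearMap ∘ₗ φ.restrictScalars k) :=
    (TwistedDual.toDual τ V).injective.comp hinj
  have h2 := (LinearMap.injective_iff_surjective_of_finrank_eq_finrank
    Subspace.dual_finrank_eq.symm).1 h1
  intro f
  obtain ⟨v, hv⟩ := h2 (TwistedDual.toDual τ V f)
  exact ⟨v, (TwistedDual.toDual τ V).injective hv⟩

/-- By Schur's lemma, the `H`-maps `V → V^†` form a space of dimension at most one. -/
theorem exists_toForm_eq_smul [IsAlgClosed k] [FiniteDimensional k V] [IsSimpleModule H V]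
    {φ : V →ₗ[H] TwistedDual τ V} (hφ : φ ≠ 0) (ψ : V →ₗ[H] TwistedDual τ V) :
    ∃ c : k, toForm ψ = c • toForm φ := by
  let e := LinearEquiv.ofBijective φ (bijective_of_ne_zero hφ)
  obtain ⟨c, hc⟩ := (IsSimpleModule.algebraMap_end_bijective_of_isAlgClosed (A := H) (V := V) k).2
    (e.symm.toLinearMap ∘ₗ ψ)
  refine ⟨c, ?_⟩
  ext v w
  have h1 : e.symm (ψ v) = c • v := (LinearMap.congr_fun hc v).symm
  have h2 : ψ v = φ (c • v) := by
    rw [← h1]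
    exact (e.apply_symm_apply (ψ v)).symm
  rw [toForm_apply, h2, ← toForm_apply, map_smul]
  rfl

theorem indicator_eq_zero_of_forall [FiniteDimensional k V] [IsSemisimpleRing H]
    (h : ∀ φ : V →ₗ[H] TwistedDual τ V, φ = 0) : indicator (character k H V) τ = 0 := by
  have h1 : average τ V (integral k H) = 0 := LinearMap.ext fun β => by
    obtain ⟨φ, hφ⟩ := average_mem (τ := τ) (integral_spec k H) β
    rw [← hφ, h φ]
    rfl
  rw [← trace_average_comp_flip, h1, LinearMap.zero_comp, map_zero]

/-- A nonzero `φ : V → V^†` spans all `H`-maps, so it is proportional to its transpose, and the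
factor is the trace of the composite of transposition with the projection onto the line of `φ`. -/
theorem toForm_swap [IsAlgClosed k] [CharZero k] [IsSemisimpleRing H]
    [FiniteDimensional k V] [IsSimpleModule H V] (hτ : ∀ h : H, τ (τ h) = h)
    {φ : V →ₗ[H] TwistedDual τ V} (hφ : φ ≠ 0) (v w : V) :
    toForm φ w v = indicator (character k H V) τ * toForm φ v w := by
  have hφ0 : toForm φ ≠ 0 := fun h => hφ (toForm_injective h)
  obtain ⟨ψ, hψ⟩ := exists_toForm_eq_flip hτ antipode_antipode_of_isSemisimpleRing φ
  obtain ⟨c, hc⟩ := exists_toForm_eq_smul hφ ψ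
  rw [hψ] at hc
  set F := average τ V (integral k H) ∘ₗ LinearMap.lflip.toLinearMap
  have hmem : ∀ β, F β ∈ Submodule.span k {toForm φ} := fun β => by
    obtain ⟨ψ, hψ⟩ := average_mem (τ := τ) (integral_spec k H) β.flip
    obtain ⟨c, hc⟩ := exists_toForm_eq_smul hφ ψ
    exact Submodule.mem_span_singleton.2 ⟨c, hc.symm.trans hψ⟩
  have hFφ : F (toForm φ) = c • toForm φ := by
    change average τ V (integral k H) (toForm φ).flip = _
    rw [hc, map_smul, average_toForm (integral_spec k H)]
  have htr : c = indicator (character k H V) τ :=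
    (trace_eq_of_forall_mem_span_singleton (M := V →ₗ[k] V →ₗ[k] k) hφ0 hmem hFφ).symm.trans
      trace_average_comp_flip
  rw [← htr]
  exact LinearMap.congr_fun₂ hc v w

end Invariants

end TwistedFS

theorem theorem4p2 {k : Type*} [Field k] [IsAlgClosed k] [CharZero k]
    {H : Type*} [Ring H] [HopfAlgebra k H] [IsSemisimpleRing H]
    (τ : H ≃ₐc[k] H) (hτ : ∀ h : H, τ (τ h) = h)
    (V : Type*) [AddCommGroup V] [Module k V] [Module H V] [IsScalarTower k H V]
    [FiniteDimensional k V] [IsSimpleModule H V] :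
    (TwistedFS.indicator (TwistedFS.character k H V) τ = 0 ∨
      TwistedFS.indicator (TwistedFS.character k H V) τ = 1 ∨
      TwistedFS.indicator (TwistedFS.character k H V) τ = -1) ∧
    (TwistedFS.indicator (TwistedFS.character k H V) τ ≠ 0 ↔
      Nonempty (V ≃ₗ[H] TwistedFS.TwistedDual τ V)) ∧
    (TwistedFS.indicator (TwistedFS.character k H V) τ = 1 ↔
      ∃ φ : V →ₗ[H] TwistedFS.TwistedDual τ V, φ ≠ 0 ∧ TwistedFS.IsSymmetric φ) ∧
    (TwistedFS.indicator (TwistedFS.character k H V) τ = -1 ↔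
      ∃ φ : V →ₗ[H] TwistedFS.TwistedDual τ V, φ ≠ 0 ∧ TwistedFS.IsSkewSymmetric φ) := by
  have hswap := fun φ : V →ₗ[H] TwistedFS.TwistedDual τ V => TwistedFS.toForm_swap hτ (φ := φ)
  have hne : ∀ φ : V →ₗ[H] TwistedFS.TwistedDual τ V, φ ≠ 0 →
      ∃ v w, TwistedFS.toForm φ v w ≠ 0 := fun φ hφ => by
    by_contra! h
    exact hφ (TwistedFS.toForm_injective (LinearMap.ext₂ h))
  have hex : TwistedFS.indicator (TwistedFS.character k H V) τ ≠ 0 →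
      ∃ φ : V →ₗ[H] TwistedFS.TwistedDual τ V, φ ≠ 0 := fun h => by
    by_contra! hall
    exact h (TwistedFS.indicator_eq_zero_of_forall hall)
  set ν := TwistedFS.indicator (TwistedFS.character k H V) τ
  -- Transposing twice gives `ν² = 1` as soon as there is a nonzero `φ`.
  have hsq : ∀ φ : V →ₗ[H] TwistedFS.TwistedDual τ V, φ ≠ 0 → ν * ν = 1 := fun φ hφ => by
    obtain ⟨v, w, hvw⟩ := hne φ hφ
    refine mul_right_cancel₀ hvw ?_
    rw [mul_assoc, ← hswap φ hφ, ← hswap φ hφ, one_mul]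
  refine ⟨?_, ⟨fun h => ?_, fun ⟨e⟩ h => ?_⟩, ⟨fun h => ?_, fun ⟨φ, hφ, hs⟩ => ?_⟩,
    ⟨fun h => ?_, fun ⟨φ, hφ, hs⟩ => ?_⟩⟩
  · by_cases h : ν = 0
    · exact Or.inl h
    · obtain ⟨φ, hφ⟩ := hex h
      exact Or.inr (mul_self_eq_one_iff.1 (hsq φ hφ))
  · obtain ⟨φ, hφ⟩ := hex h
    exact ⟨LinearEquiv.ofBijective φ (TwistedFS.bijective_of_ne_zero hφ)⟩
  · have := IsSimpleModule.nontrivial H V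
    obtain ⟨v, hv⟩ := exists_ne (0 : V)
    have he : e.toLinearMap ≠ 0 := fun h0 =>
      hv (e.injective ((LinearMap.congr_fun h0 v).trans (map_zero e).symm))
    have h1 := hsq _ he
    rw [h, mul_zero] at h1
    exact zero_ne_one h1
  · obtain ⟨φ, hφ⟩ := hex (by rw [h]; exact one_ne_zero)
    refine ⟨φ, hφ, fun v w => ?_⟩
    have h1 := hswap φ hφ w v
    rwa [h, one_mul] at h1
  · obtain ⟨v, w, hvw⟩ := hne φ hφ
    refine mul_right_cancel₀ hvw ?_
    rw [← hswap φ hφ, one_mul]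
    exact hs w v
  · obtain ⟨φ, hφ⟩ := hex (by rw [h]; exact neg_ne_zero.2 one_ne_zero)
    refine ⟨φ, hφ, fun v w => ?_⟩
    have h1 := hswap φ hφ w v
    rwa [h, neg_one_mul] at h1
  · obtain ⟨v, w, hvw⟩ := hne φ hφ
    refine mul_right_cancel₀ hvw ?_
    rw [← hswap φ hφ, neg_one_mul]
    exact hs w v
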